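/- Let $T>0$, let $\Omega$ be a countable set and let $(\Omega,2^{\Omega},\mathbb P)$ be a probability space with a filtration $(\mathcal F_t)_{t\in[0,T]}$ satisfying the usual conditions. Write $\mathbb E_t=\mathbb E[\,\cdot\mid\mathcal F_t]$, and let $\mathcal L^2$ be the space of progressively measurable $u:[0,T]\times\Omega\to\mathbb R$ with $\mathbb E\big[\int_0^T|u_t|^2\,dt\big]<\infty$. Let $\gamma>0$, $\phi,\varrho\ge 0$, $X_0>0$; let $S\in\mathcal L^2$ with $S_T\in L^2(\mathbb P)$, let $g\in\mathcal L^2$, and put $\alpha_t=\mathbb E_t[S_T-S_t]$. Let $G:[0,T]^2\to\mathbb R$ be a measurable Volterra kernel with $\sup_{t\in[0,T]}\int_0^t|G(t,s)|^2\,ds<\infty$. For a kernel $K$ write $$(\mathbf K u)_t=\int_0^t K(t,s)u_s\,ds,\qquad (\mathbf K^*u)_t=\int_t^T K(s,t)\,\mathbb E_t[u_s]\,ds,$$ and let $H_{\phi,\varrho}(t,s)=(\phi(T-t)+\varrho)\mathbf 1_{\{t>s\}}$. For $h:\mathbb R\to\mathbb R$ and $u\in\mathcal L^2$ set $X^u_t=X_0+\int_0^t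 u_s\,ds$, $Z^u_t=g_t+(\mathbf G u)_t$, and $$\mathcal J(u)=\mathbb E\Big[\int_0^T\big(\alpha_t-\tfrac{\gamma}{2}u_t-h(Z^u_t)\big)u_t\,dt-\tfrac{\phi}{2}\int_0^T (X^u_t)^2\,dt-\tfrac{\varrho}{2}(X^u_T)^2\Big]+X_0\,\mathbb E[S_T].$$ **Theorem.** Assume that $h:\mathbb R\to\mathbb R$ is globally Lipschitz continuous and of strictly sublinear growth, i.e. there are $0<\zeta<1$ and $C$ with $|h(x)|\le C(1+|x|^{\zeta})$ for all $x\in\mathbb R$. Then all integrals defining $\mathcal J(u)$ converge absolutely for every $u\in\mathcal L^2$, and there exists a global maximizer $\hat u\in\mathcal L^2$, that is, $\mathcal J(\hat u)=\sup_{u\in\mathcal L^2}\mathcal J(u)$. If, in addition, $h$ is differentiable with bounded derivative $h'$, then every global maximizer $\hat u\in\mathcal L^2$ solves the nonlinear stochastic Fredholm equation $$\gamma\hat u_t+h(Z^{\hat u}_t)+\big(\mathbf G^*(h'(Z^{\hat u})\hat u)\big)_t+(\mathbf H_{\phi,\varrho}\hat u)_t+(\mathbf H_{\phi,\varrho}^*\hat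 u)_t=\alpha_t-X_0\big(\phi(T-t)+\varrho\big)\qquad (dt\otimes\mathbb P)\text{-a.e.},$$ where the integrals occurring in the equation converge absolutely $(dt\otimes\mathbb P)$-a.e. -/

import Mathlib

open MeasureTheory
open scoped ENNReal

/- Lebesgue measure `dt` on the subtype `[0,T]`. -/
attribute [local instance] Measure.Subtype.measureSpace

noncomputable section

namespace PriceImpact

/-- The terminal time `T`, as a point of the time interval `[0,T]`. -/
def endTime {T : ℝ} (hT : 0 < T) : Set.Icc (0 : ℝ) T := ⟨T, hT.le, le_rfl⟩

/-- The usual conditions on a filtration `(ℱ_t)` indexed by `[0,T]`: it is right-continuous and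
every `ℱ_t` contains all `P`-null sets. -/
structure UsualConditions {Ω : Type*} [mΩ : MeasurableSpace Ω] {T : ℝ}
    (ℱ : Filtration (Set.Icc (0 : ℝ) T) mΩ) (P : Measure Ω) : Prop where
  rightContinuous : ℱ.IsRightContinuous
  complete : ∀ t : Set.Icc (0 : ℝ) T, ∀ A : Set Ω, P A = 0 → MeasurableSet[ℱ t] A

/-- Membership in `𝓛²`: progressively measurable processes `u` on `[0,T] × Ω` that are square
integrable for `dt ⊗ P`. -/
def MemL2 {Ω : Type*} [mΩ : MeasurableSpace Ω] {T : ℝ}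
    (ℱ : Filtration (Set.Icc (0 : ℝ) T) mΩ) (P : Measure Ω)
    (u : Set.Icc (0 : ℝ) T → Ω → ℝ) : Prop :=
  IsStronglyProgressive ℱ u ∧
    MemLp (fun p : Set.Icc (0 : ℝ) T × Ω => u p.1 p.2) 2 (volume.prod P)

/-- Admissible kernels: measurable `G` with `sup_{t ∈ [0,T]} ∫₀ᵗ |G(t,s)|² ds < ∞`. Only the
values `G(t,s)` with `s ≤ t` ever enter. -/
structure AdmissibleKernel {T : ℝ} (G : Set.Icc (0 : ℝ) T → Set.Icc (0 : ℝ) T → ℝ) : Prop where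
  measurable : Measurable (Function.uncurry G)
  bounded : (⨆ t : Set.Icc (0 : ℝ) T, ∫⁻ s in Set.Iic t, ‖G t s‖ₑ ^ 2) < ∞

/-- The Volterra operator `(𝐊u)_t = ∫₀ᵗ K(t,s) u_s ds`. -/
def volterraOp {Ω : Type*} {T : ℝ} (K : Set.Icc (0 : ℝ) T → Set.Icc (0 : ℝ) T → ℝ)
    (u : Set.Icc (0 : ℝ) T → Ω → ℝ) (t : Set.Icc (0 : ℝ) T) (ω : Ω) : ℝ :=
  ∫ s in Set.Iic t, K t s * u s ω

/-- The adjoint operator `(𝐊*u)_t = ∫ₜᵀ K(s,t) 𝔼[u_s | ℱ_t] ds`. -/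
def volterraAdj {Ω : Type*} [mΩ : MeasurableSpace Ω] {T : ℝ}
    (ℱ : Filtration (Set.Icc (0 : ℝ) T) mΩ) (P : Measure Ω)
    (K : Set.Icc (0 : ℝ) T → Set.Icc (0 : ℝ) T → ℝ)
    (u : Set.Icc (0 : ℝ) T → Ω → ℝ) (t : Set.Icc (0 : ℝ) T) (ω : Ω) : ℝ :=
  ∫ s in Set.Ici t, K s t * (P[u s | ℱ t]) ω

/-- The kernel `H_{φ,ϱ}(t,s) = (φ (T - t) + ϱ) 1_{t > s}`. -/
def kernelH {T : ℝ} (φ ϱ : ℝ) (t s : Set.Icc (0 : ℝ) T) : ℝ :=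
  if s < t then φ * (T - t) + ϱ else 0

/-- The inventory `X^u_t = X₀ + ∫₀ᵗ u_s ds`. -/
def inventory {Ω : Type*} {T : ℝ} (X₀ : ℝ) (u : Set.Icc (0 : ℝ) T → Ω → ℝ)
    (t : Set.Icc (0 : ℝ) T) (ω : Ω) : ℝ :=
  X₀ + ∫ s in Set.Iic t, u s ω

/-- The price distortion `Z^u_t = g_t + (𝐆u)_t`. -/
def distortion {Ω : Type*} {T : ℝ} (G : Set.Icc (0 : ℝ) T → Set.Icc (0 : ℝ) T → ℝ)
    (g u : Set.Icc (0 : ℝ) T → Ω → ℝ) (t : Set.Icc (0 : ℝ) T) (ω : Ω) : ℝ :=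
  g t ω + volterraOp G u t ω

/-- The price impact `I^u_t = (γ/2) u_t + h(Z^u_t)`. -/
def impactCost {Ω : Type*} {T : ℝ} (γ : ℝ) (h : ℝ → ℝ)
    (G : Set.Icc (0 : ℝ) T → Set.Icc (0 : ℝ) T → ℝ)
    (g u : Set.Icc (0 : ℝ) T → Ω → ℝ) (t : Set.Icc (0 : ℝ) T) (ω : Ω) : ℝ :=
  γ / 2 * u t ω + h (distortion G g u t ω)

/-- The alpha signal `α_t = 𝔼[S_T - S_t | ℱ_t]`. -/
def alphaSignal {Ω : Type*} [mΩ : MeasurableSpace Ω] {T : ℝ} (hT : 0 < T)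
    (ℱ : Filtration (Set.Icc (0 : ℝ) T) mΩ) (P : Measure Ω)
    (S : Set.Icc (0 : ℝ) T → Ω → ℝ) (t : Set.Icc (0 : ℝ) T) (ω : Ω) : ℝ :=
  (P[fun ω' => S (endTime hT) ω' - S t ω' | ℱ t]) ω

/-- The performance functional
`J(u) = 𝔼[∫₀ᵀ (α_t - I^u_t) u_t dt - (φ/2) ∫₀ᵀ (X^u_t)² dt - (ϱ/2) (X^u_T)²] + X₀ 𝔼[S_T]`. -/
def performance {Ω : Type*} [mΩ : MeasurableSpace Ω] {T : ℝ} (hT : 0 < T)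
    (ℱ : Filtration (Set.Icc (0 : ℝ) T) mΩ) (P : Measure Ω) (γ φ ϱ X₀ : ℝ) (h : ℝ → ℝ)
    (G : Set.Icc (0 : ℝ) T → Set.Icc (0 : ℝ) T → ℝ)
    (S g u : Set.Icc (0 : ℝ) T → Ω → ℝ) : ℝ :=
  (∫ ω, ((∫ t, (alphaSignal hT ℱ P S t ω - impactCost γ h G g u t ω) * u t ω)
      - φ / 2 * (∫ t, inventory X₀ u t ω ^ 2)
      - ϱ / 2 * inventory X₀ u (endTime hT) ω ^ 2) ∂P)
    + X₀ * ∫ ω, S (endTime hT) ω ∂P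

/-- All integrals in the definition of `J(u)` converge absolutely, so that `J(u)` is a genuine
real number. -/
structure PerformanceWellDefined {Ω : Type*} [mΩ : MeasurableSpace Ω] {T : ℝ} (hT : 0 < T)
    (ℱ : Filtration (Set.Icc (0 : ℝ) T) mΩ) (P : Measure Ω) (γ X₀ : ℝ) (h : ℝ → ℝ)
    (G : Set.Icc (0 : ℝ) T → Set.Icc (0 : ℝ) T → ℝ)
    (S g u : Set.Icc (0 : ℝ) T → Ω → ℝ) : Prop where
  gain : Integrable (fun p : Set.Icc (0 : ℝ) T × Ω =>
    (alphaSignal hT ℱ P S p.1 p.2 - impactCost γ h G g u p.1 p.2) * u p.1 p.2) (volume.prod P)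
  running : Integrable (fun p : Set.Icc (0 : ℝ) T × Ω => inventory X₀ u p.1 p.2 ^ 2)
    (volume.prod P)
  terminal : Integrable (fun ω => inventory X₀ u (endTime hT) ω ^ 2) P

/-- `û ∈ 𝓛²` maximizes `J` over `𝓛²`. -/
def IsGlobalMaximizer {Ω : Type*} [mΩ : MeasurableSpace Ω] {T : ℝ} (hT : 0 < T)
    (ℱ : Filtration (Set.Icc (0 : ℝ) T) mΩ) (P : Measure Ω) (γ φ ϱ X₀ : ℝ) (h : ℝ → ℝ)
    (G : Set.Icc (0 : ℝ) T → Set.Icc (0 : ℝ) T → ℝ)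
    (S g uhat : Set.Icc (0 : ℝ) T → Ω → ℝ) : Prop :=
  MemL2 ℱ P uhat ∧ ∀ u, MemL2 ℱ P u →
    performance hT ℱ P γ φ ϱ X₀ h G S g u ≤ performance hT ℱ P γ φ ϱ X₀ h G S g uhat

/-- The operator `𝐀(u)_t = h(Z^u_t) + (𝐆*(h'(Z^u) u))_t`. -/
def operatorA {Ω : Type*} [mΩ : MeasurableSpace Ω] {T : ℝ}
    (ℱ : Filtration (Set.Icc (0 : ℝ) T) mΩ) (P : Measure Ω) (h : ℝ → ℝ)
    (G : Set.Icc (0 : ℝ) T → Set.Icc (0 : ℝ) T → ℝ)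
    (g u : Set.Icc (0 : ℝ) T → Ω → ℝ) (t : Set.Icc (0 : ℝ) T) (ω : Ω) : ℝ :=
  h (distortion G g u t ω)
    + volterraAdj ℱ P G (fun s ω' => deriv h (distortion G g u s ω') * u s ω') t ω

/-- `u ∈ 𝓛²` solves the nonlinear stochastic Fredholm equation
`γ u_t + 𝐀(u)_t + (𝐇u)_t + (𝐇*u)_t = α_t - X₀ (φ (T - t) + ϱ)` for `dt ⊗ P`-a.e. `(t,ω)`. -/
def IsFredholmSolution {Ω : Type*} [mΩ : MeasurableSpace Ω] {T : ℝ} (hT : 0 < T)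
    (ℱ : Filtration (Set.Icc (0 : ℝ) T) mΩ) (P : Measure Ω) (γ φ ϱ X₀ : ℝ) (h : ℝ → ℝ)
    (G : Set.Icc (0 : ℝ) T → Set.Icc (0 : ℝ) T → ℝ)
    (S g u : Set.Icc (0 : ℝ) T → Ω → ℝ) : Prop :=
  MemL2 ℱ P u ∧ ∀ᵐ p : Set.Icc (0 : ℝ) T × Ω ∂(volume.prod P),
    γ * u p.1 p.2 + operatorA ℱ P h G g u p.1 p.2
        + volterraOp (kernelH φ ϱ) u p.1 p.2 + volterraAdj ℱ P (kernelH φ ϱ) u p.1 p.2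
      = alphaSignal hT ℱ P S p.1 p.2 - X₀ * (φ * (T - p.1) + ϱ)

/-- Absolute convergence, for `dt ⊗ P`-a.e. `(t,ω)`, of the integrals in the Fredholm equation:
those of `𝐆u`, `𝐆*(h'(Z^u) u)`, `𝐇u` and `𝐇*u`. -/
def FredholmIntegralsConverge {Ω : Type*} [mΩ : MeasurableSpace Ω] {T : ℝ}
    (ℱ : Filtration (Set.Icc (0 : ℝ) T) mΩ) (P : Measure Ω) (φ ϱ : ℝ) (h : ℝ → ℝ)
    (G : Set.Icc (0 : ℝ) T → Set.Icc (0 : ℝ) T → ℝ)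
    (g u : Set.Icc (0 : ℝ) T → Ω → ℝ) : Prop :=
  ∀ᵐ p : Set.Icc (0 : ℝ) T × Ω ∂(volume.prod P),
    IntegrableOn (fun s => G p.1 s * u s p.2) (Set.Iic p.1) ∧
    IntegrableOn (fun s =>
      G s p.1 * (P[fun ω' => deriv h (distortion G g u s ω') * u s ω' | ℱ p.1]) p.2)
      (Set.Ici p.1) ∧
    IntegrableOn (fun s => kernelH φ ϱ p.1 s * u s p.2) (Set.Iic p.1) ∧
    IntegrableOn (fun s => kernelH φ ϱ s p.1 * (P[u s | ℱ p.1]) p.2) (Set.Ici p.1)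

/-- Strictly sublinear growth: `|h(x)| = O(1 + |x|^ζ)` on `ℝ` for some `0 < ζ < 1`. -/
def StrictlySublinear (h : ℝ → ℝ) : Prop :=
  ∃ ζ : ℝ, 0 < ζ ∧ ζ < 1 ∧ ∃ C : ℝ, ∀ x : ℝ, |h x| ≤ C * (1 + |x| ^ ζ)

/-- `h` is differentiable with bounded derivative. -/
def DifferentiableBoundedDeriv (h : ℝ → ℝ) : Prop :=
  Differentiable ℝ h ∧ ∃ C : ℝ, ∀ x : ℝ, |deriv h x| ≤ C

end PriceImpact

end

open PriceImpact

namespace PriceImpact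

open Filter Topology

section

variable {T : ℝ}

/-! ### The time interval -/

/-! Existence is the direct method in `L²(dt ⊗ P)`. Strict sublinearity gives `h(x)² ≤ ε x² + M` for
every `ε > 0` (`StrictlySublinear.sq_le`). Since `‖𝐆u‖` is at most a constant times `‖u‖`, the
impact term is absorbed by the cost `(γ/2)‖u‖²`, and `J(u) ≤ c - (γ/4)‖u‖²`
(`exists_performance_le`). A maximizing sequence is therefore bounded and has a weakly convergent
subsequence. Over a countable `Ω`, progressive measurability is measurability for the single
σ-algebra `progSigma` (`isStronglyProgressive_iff`), so `𝓛²` is a closed subspace and contains the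
weak limit.

The quadratic costs are convex, hence weakly lower semicontinuous. The term `h(Z^u) u` has no
convexity; it is shown to be weakly continuous instead. Countability is decisive here: if `P {ω} >
0`, then `u ↦ (𝐊u)_t(ω)` is a bounded linear functional (`integral_representer_mul`), so weak
convergence of `u_n` forces pointwise a.e. convergence of `Z^{u_n}`. By sublinearity `h(Z^{u_n})²`
cannot concentrate, so `h(Z^{u_n})` converges strongly in `L²`, and its product with the weakly
convergent `u_n` passes to the limit (`tendsto_integral_comp_mul`).

For the equation, `J(û + εv)` is differentiated at `ε = 0` (`firstOrderCondition`). With `v = 1_A`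
for `A` in `progSigma`, Fubini and the defining property of conditional expectation move `𝐆` and `𝐇`
to their adjoints (`setIntegral_adjVersion`), while the inventory penalty becomes `𝐇 + 𝐇*` by
symmetrizing a kernel (`integral_penalty_eq`). The defect of the equation then has a progressively
measurable version with zero integral over every such `A`, so it vanishes a.e.

Conditional expectations are chosen separately for each time. Averages over the atoms of `ℱ t` agree
with them at every point of positive mass and are jointly measurable, which supplies the versions
that Fubini needs. -/

instance isFiniteMeasure_volume_Icc :
    IsFiniteMeasure (volume : Measure (Set.Icc (0 : ℝ) T)) := by
  constructor
  rw [Measure.Subtype.volume_univ measurableSet_Icc.nullMeasurableSet]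
  simp

theorem volume_Icc_apply {s : Set (Set.Icc (0 : ℝ) T)} :
    volume s = volume ((↑) '' s : Set ℝ) :=
  Measure.Subtype.volume_def (u := Set.Icc (0 : ℝ) T) ▸
    comap_subtype_coe_apply measurableSet_Icc _ _

instance nullSingletonClass_volume_Icc : NullSingletonClass (volume : Measure (Set.Icc (0 : ℝ) T)) := by
  constructor
  intro x
  rw [volume_Icc_apply]
  simp

theorem volumeReal_Ici (t : Set.Icc (0 : ℝ) T) :
    (volume : Measure (Set.Icc (0 : ℝ) T)).real (Set.Ici t) = T - t := by
  rw [measureReal_def, volume_Icc_apply]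
  have : ((↑) '' Set.Ici t : Set ℝ) = Set.Icc (t : ℝ) T := by
    ext x
    simp only [Set.mem_image, Set.mem_Ici, Set.mem_Icc]
    constructor
    · rintro ⟨y, hy, rfl⟩
      exact ⟨hy, y.2.2⟩
    · rintro ⟨h1, h2⟩
      exact ⟨⟨x, t.2.1.trans h1, h2⟩, h1, rfl⟩
  rw [this, Real.volume_Icc, ENNReal.toReal_ofReal (sub_nonneg.2 t.2.2)]

theorem Iic_endTime (hT : 0 < T) : Set.Iic (endTime hT) = Set.univ :=
  Set.eq_univ_of_forall fun t => t.2.2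

/-! ### Measurable atoms of a countable space -/

/-- A function constant on atoms has preimages that are unions of atoms, and countability of `Ω`
makes these unions countable. This reduces adaptedness to a pointwise check. -/
theorem measurable_of_forall_measurableAtom {Ω : Type*} [Countable Ω] {m : MeasurableSpace Ω} {f : Ω → ℝ}
    (hf : ∀ ω, ∀ ω' ∈ @measurableAtom Ω m ω, f ω' = f ω) : Measurable[m] f := by
  intro B _
  have : f ⁻¹' B = ⋃ ω ∈ f ⁻¹' B, @measurableAtom Ω m ω := by
    ext ω
    simp only [Set.mem_iUnion]
    constructor
    · exact fun h => ⟨ω, h, mem_measurableAtom_self ω⟩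
    · rintro ⟨ω', h', h⟩
      rw [Set.mem_preimage, hf ω' ω h]
      exact h'
  rw [this]
  exact MeasurableSet.biUnion (Set.to_countable _)
    fun ω _ => MeasurableSet.measurableAtom_of_countable ω

theorem eq_of_mem_measurableAtom {Ω : Type*} {m : MeasurableSpace Ω} {f : Ω → ℝ}
    (hf : Measurable[m] f) {ω ω' : Ω} (h : ω' ∈ @measurableAtom Ω m ω) : f ω' = f ω :=
  mem_of_mem_measurableAtom (s := f ⁻¹' {f ω}) h (hf (measurableSet_singleton _)) rfl

theorem measurableAtom_anti {Ω : Type*} {m m' : MeasurableSpace Ω} (h : m ≤ m') (ω : Ω) :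
    @measurableAtom Ω m' ω ⊆ @measurableAtom Ω m ω := by
  intro x hx
  simp only [measurableAtom, Set.mem_iInter] at hx ⊢
  exact fun s hs hm => hx s hs (h _ hm)

/-- The average of `X` over the atom of `m` containing `ω`. -/
noncomputable def atomAverage {Ω : Type*} (m : MeasurableSpace Ω) [mΩ : MeasurableSpace Ω]
    (P : Measure Ω) (X : Ω → ℝ) (ω : Ω) : ℝ :=
  (∫ ω' in @measurableAtom Ω m ω, X ω' ∂P) / P.real (@measurableAtom Ω m ω)

/-- The conditional expectation is constant on the atom of `ω`, which has positive mass because it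
contains `ω`; its integral over the atom then determines the constant. The right-hand side is an
explicit formula, with no choice of version. -/
theorem condExp_eq_atomAverage {Ω : Type*} [Countable Ω] {m mΩ : MeasurableSpace Ω} {P : Measure Ω} [IsProbabilityMeasure P]
    (hm : m ≤ mΩ) {X : Ω → ℝ} (hX : Integrable X P) {ω : Ω}
    (hω : P {ω} ≠ 0) : (P[X | m]) ω = atomAverage m P X ω := by
  have hA : MeasurableSet[m] (@measurableAtom Ω m ω) :=
    @MeasurableSet.measurableAtom_of_countable Ω m _ ω
  have h1 := setIntegral_condExp hm hX hA
  have h2 : ∫ ω' in @measurableAtom Ω m ω, (P[X | m]) ω' ∂P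
      = P.real (@measurableAtom Ω m ω) * (P[X | m]) ω := by
    rw [setIntegral_congr_fun (g := fun _ => (P[X | m]) ω) (hm _ hA)]
    · simp
    · intro ω' h'
      exact eq_of_mem_measurableAtom stronglyMeasurable_condExp.measurable h'
  have h3 : P.real (@measurableAtom Ω m ω) ≠ 0 := by
    rw [measureReal_ne_zero_iff]
    intro h0
    exact hω (measure_mono_null (by simp [mem_measurableAtom_self]) h0)
  rw [atomAverage, ← h1, h2, mul_div_cancel_left₀ _ h3]

theorem atomAverage_eq_of_mem {Ω : Type*} {m mΩ : MeasurableSpace Ω} {P : Measure Ω} {X : Ω → ℝ}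
    {ω ω' : Ω} (h : ω' ∈ @measurableAtom Ω m ω) : atomAverage m P X ω' = atomAverage m P X ω := by
  rw [atomAverage, atomAverage, @measurableAtom_eq_of_mem Ω m _ _ h]

variable {Ω : Type*} [mΩ : MeasurableSpace Ω]

/-! ### Progressive measurability over a countable sample space -/

/-- The σ-algebra of the measurable subsets of `[0,T] × Ω` with adapted sections. -/
abbrev progSigma (ℱ : Filtration (Set.Icc (0 : ℝ) T) mΩ) :
    MeasurableSpace (Set.Icc (0 : ℝ) T × Ω) :=
  Prod.instMeasurableSpace ⊓ ⨅ t, (ℱ t).map (Prod.mk t)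

theorem progSigma_le (ℱ : Filtration (Set.Icc (0 : ℝ) T) mΩ) :
    progSigma ℱ ≤ Prod.instMeasurableSpace :=
  inf_le_left

theorem measurableSet_progSigma {ℱ : Filtration (Set.Icc (0 : ℝ) T) mΩ}
    {A : Set (Set.Icc (0 : ℝ) T × Ω)} :
    MeasurableSet[progSigma ℱ] A ↔
      MeasurableSet A ∧ ∀ t, MeasurableSet[ℱ t] {ω | (t, ω) ∈ A} := by
  rw [progSigma, MeasurableSpace.measurableSet_inf, MeasurableSpace.measurableSet_iInf]
  rfl

theorem measurable_progSigma {ℱ : Filtration (Set.Icc (0 : ℝ) T) mΩ}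
    {f : Set.Icc (0 : ℝ) T × Ω → ℝ} :
    Measurable[progSigma ℱ] f ↔ Measurable f ∧ ∀ t, Measurable[ℱ t] fun ω => f (t, ω) := by
  constructor
  · intro hf
    exact ⟨fun B hB => (measurableSet_progSigma.1 (hf hB)).1,
      fun t B hB => (measurableSet_progSigma.1 (hf hB)).2 t⟩
  · rintro ⟨h1, h2⟩ B hB
    exact measurableSet_progSigma.2 ⟨h1 hB, fun t => h2 t hB⟩

/-- With `Ω` countable, joint measurability and adaptedness already give progressive measurability.
The gain is that `𝓛²` becomes an `L²` space over one sub-σ-algebra, so it is stable under weak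
limits and can be tested on indicators. -/
theorem isStronglyProgressive_iff [Countable Ω] (hT : 0 < T)
    {ℱ : Filtration (Set.Icc (0 : ℝ) T) mΩ} {u : Set.Icc (0 : ℝ) T → Ω → ℝ} :
    IsStronglyProgressive ℱ u ↔
      Measurable[progSigma ℱ] fun p : Set.Icc (0 : ℝ) T × Ω => u p.1 p.2 := by
  rw [measurable_progSigma]
  constructor
  · intro h
    refine ⟨?_, fun t => (h.stronglyAdapted t).measurable⟩
    have h1 := (h (endTime hT)).measurable
    have h2 : Measurable[Prod.instMeasurableSpace, Subtype.instMeasurableSpace.prod (ℱ (endTime hT))]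
        fun p : Set.Icc (0 : ℝ) T × Ω => ((⟨p.1, p.1.2.2⟩ : Set.Iic (endTime hT)), p.2) := by
      refine @Measurable.prodMk _ _ _ _ _ (ℱ (endTime hT)) _ _ ?_ ?_
      · exact measurable_fst.subtype_mk
      · exact measurable_snd.mono le_rfl (ℱ.le _)
    exact h1.comp h2
  · rintro ⟨h1, h2⟩ t
    refine @Measurable.stronglyMeasurable _ _ _ (Subtype.instMeasurableSpace.prod (ℱ t)) _ _ _ _ _ ?_
    refine @measurable_from_prod_countable_left' _ _ _ _ (ℱ t) _ _ _ ?_ ?_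
    · intro ω
      exact h1.comp (measurable_subtype_coe.prodMk measurable_const)
    · intro ω ω' s hω
      -- For `s ≤ t` the atoms of `ℱ t` lie inside those of `ℱ s`, so the `ℱ s`-measurable `u s` is
      -- constant on them.
      exact eq_of_mem_measurableAtom (h2 s) (measurableAtom_anti (ℱ.mono s.2) ω hω)

theorem memL2_iff [Countable Ω] (hT : 0 < T)
    {ℱ : Filtration (Set.Icc (0 : ℝ) T) mΩ} {P : Measure Ω} {u : Set.Icc (0 : ℝ) T → Ω → ℝ} :
    MemL2 ℱ P u ↔ (Measurable[progSigma ℱ] fun p : Set.Icc (0 : ℝ) T × Ω => u p.1 p.2) ∧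
      MemLp (fun p : Set.Icc (0 : ℝ) T × Ω => u p.1 p.2) 2 (volume.prod P) := by
  rw [MemL2, isStronglyProgressive_iff hT]

/-- As `s` increases the atom of `ω` in `ℱ s` shrinks, so the times at which it still contains a
given `ω'` form a lower set of `[0,T]`, hence a measurable one. Summing over the countably many `ω'`
keeps measurability. -/
theorem measurable_atomAverage [Countable Ω] [DiscreteMeasurableSpace Ω] {P : Measure Ω}
    [IsProbabilityMeasure P] (ℱ : Filtration (Set.Icc (0 : ℝ) T) mΩ)
    {w : Set.Icc (0 : ℝ) T → Ω → ℝ} (hw : Measurable fun p : Set.Icc (0 : ℝ) T × Ω => w p.1 p.2) :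
    Measurable fun q : (Set.Icc (0 : ℝ) T × Set.Icc (0 : ℝ) T) × Ω =>
      atomAverage (ℱ q.1.1) P (w q.1.2) q.2 := by
  refine measurable_from_prod_countable_left fun ω => ?_
  have hset : ∀ ω', MeasurableSet {s | ω' ∈ @measurableAtom Ω (ℱ s) ω} := by
    intro ω'
    have : IsLowerSet {s | ω' ∈ @measurableAtom Ω (ℱ s) ω} :=
      fun s s' h hs => measurableAtom_anti (ℱ.mono h) ω hs
    exact this.ordConnected.measurableSet
  have key : ∀ v : Set.Icc (0 : ℝ) T → Ω → ℝ,
      (Measurable fun p : Set.Icc (0 : ℝ) T × Ω => v p.1 p.2) →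
      Measurable fun q : Set.Icc (0 : ℝ) T × Set.Icc (0 : ℝ) T =>
        ∫ ω' in @measurableAtom Ω (ℱ q.1) ω, v q.2 ω' ∂P := by
    intro v hv
    have : (fun q : Set.Icc (0 : ℝ) T × Set.Icc (0 : ℝ) T =>
        ∫ ω' in @measurableAtom Ω (ℱ q.1) ω, v q.2 ω' ∂P)
        = fun q => ∫ ω', (@measurableAtom Ω (ℱ q.1) ω).indicator (v q.2) ω' ∂P := by
      ext q
      rw [integral_indicator (MeasurableSet.of_discrete)]
    rw [this]
    refine (StronglyMeasurable.integral_prod_right' (f := fun r :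
      (Set.Icc (0 : ℝ) T × Set.Icc (0 : ℝ) T) × Ω =>
        (@measurableAtom Ω (ℱ r.1.1) ω).indicator (v r.1.2) r.2) ?_).measurable
    refine Measurable.stronglyMeasurable ?_
    refine measurable_from_prod_countable_left fun ω' => ?_
    have h1 : (fun q : Set.Icc (0 : ℝ) T × Set.Icc (0 : ℝ) T =>
        (@measurableAtom Ω (ℱ q.1) ω).indicator (v q.2) ω')
        = (Prod.fst ⁻¹' {s | ω' ∈ @measurableAtom Ω (ℱ s) ω}).indicator
          (fun q => v q.2 ω') := by
      ext q
      simp [Set.indicator]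
    show Measurable (fun q : Set.Icc (0 : ℝ) T × Set.Icc (0 : ℝ) T =>
        (@measurableAtom Ω (ℱ q.1) ω).indicator (v q.2) ω')
    rw [h1]
    refine Measurable.indicator ?_ ((hset ω').preimage measurable_fst)
    exact hv.comp (measurable_snd.prodMk measurable_const)
  -- The denominator of the average is the same integral with integrand `1`.
  have h2 := key (fun _ _ => 1) measurable_const
  simp only [integral_const, measureReal_restrict_apply_univ, smul_eq_mul, mul_one] at h2
  exact (key w hw).div h2

end

section

variable {T : ℝ} {Ω : Type*} [mΩ : MeasurableSpace Ω]

/-! ### Sections of processes over a countable sample space -/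

theorem forall_of_ae {P : Measure Ω} {p : Ω → Prop} (h : ∀ᵐ ω ∂P, p ω) {ω : Ω} (hω : P {ω} ≠ 0) :
    p ω := by
  by_contra hp
  exact hω (measure_mono_null (Set.singleton_subset_iff.2 hp) (ae_iff.1 h))

theorem ae_singleton_ne_zero [Countable Ω] (P : Measure Ω) : ∀ᵐ ω ∂P, P {ω} ≠ 0 := by
  rw [ae_iff]
  simp only [not_not]
  exact (measure_null_iff_singleton (Set.to_countable _)).2 fun ω h => h

theorem ae_prod_singleton_ne_zero [Countable Ω] (P : Measure Ω) [IsProbabilityMeasure P] :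
    ∀ᵐ p : Set.Icc (0 : ℝ) T × Ω ∂(volume.prod P), P {p.2} ≠ 0 :=
  Measure.quasiMeasurePreserving_snd.ae (ae_singleton_ne_zero P)

variable {P : Measure Ω} [IsProbabilityMeasure P]

theorem memLp_section {u : Set.Icc (0 : ℝ) T → Ω → ℝ}
    (hm : Measurable fun p : Set.Icc (0 : ℝ) T × Ω => u p.1 p.2)
    (hu : MemLp (fun p : Set.Icc (0 : ℝ) T × Ω => u p.1 p.2) 2 (volume.prod P))
    {ω : Ω} (hω : P {ω} ≠ 0) : MemLp (fun t => u t ω) 2 volume := by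
  have h1 := hu.integrable_sq.prod_left_ae
  have h2 := forall_of_ae h1 hω
  exact (memLp_two_iff_integrable_sq
    (hm.comp (measurable_id.prodMk measurable_const)).aestronglyMeasurable).2 h2

/-! ### Volterra operators -/

variable {K : Set.Icc (0 : ℝ) T → Set.Icc (0 : ℝ) T → ℝ}

/-- The supremum over `t` of the squared `L²` norms of `K(t,·)` on `[0,t]`. -/
noncomputable def kernelBound (K : Set.Icc (0 : ℝ) T → Set.Icc (0 : ℝ) T → ℝ) : ℝ≥0∞ :=
  ⨆ t : Set.Icc (0 : ℝ) T, ∫⁻ s in Set.Iic t, ‖K t s‖ₑ ^ 2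

theorem AdmissibleKernel.measurable_left (hK : AdmissibleKernel K) (t : Set.Icc (0 : ℝ) T) :
    Measurable (K t) :=
  hK.measurable.comp (measurable_const.prodMk measurable_id)

theorem AdmissibleKernel.memLp (hK : AdmissibleKernel K) (t : Set.Icc (0 : ℝ) T) :
    MemLp (K t) 2 (volume.restrict (Set.Iic t)) := by
  refine ⟨(hK.measurable_left t).aestronglyMeasurable, ?_⟩
  rw [eLpNorm_lt_top_iff_lintegral_rpow_enorm_lt_top (by simp) (by simp)]
  refine lt_of_le_of_lt ?_ hK.bounded
  refine le_trans (le_of_eq ?_) (le_iSup _ t)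
  simp

theorem AdmissibleKernel.of_bounded (hK : Measurable (Function.uncurry K)) {c : ℝ}
    (hc : ∀ t s, |K t s| ≤ c) : AdmissibleKernel K := by
  refine ⟨hK, ?_⟩
  have : ∀ t : Set.Icc (0 : ℝ) T, ∫⁻ s in Set.Iic t, ‖K t s‖ₑ ^ 2
      ≤ ENNReal.ofReal c ^ 2 * volume (Set.univ : Set (Set.Icc (0 : ℝ) T)) := by
    intro t
    calc ∫⁻ s in Set.Iic t, ‖K t s‖ₑ ^ 2 ≤ ∫⁻ s, ‖K t s‖ₑ ^ 2 := setLIntegral_le_lintegral _ _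
      _ ≤ ∫⁻ s, ENNReal.ofReal c ^ 2 := by
          gcongr with s
          rw [Real.enorm_eq_ofReal_abs]
          exact ENNReal.ofReal_le_ofReal (hc t s)
      _ = _ := by simp
  refine lt_of_le_of_lt (iSup_le this) ?_
  exact ENNReal.mul_lt_top (ENNReal.pow_lt_top ENNReal.ofReal_lt_top) (measure_lt_top _ _)

/-- With this kernel `X^u - X₀` is a Volterra operator, so all estimates below apply to the
inventory. -/
theorem admissibleKernel_one : AdmissibleKernel (T := T) fun _ _ => 1 :=
  .of_bounded measurable_const (c := 1) (by simp)

theorem abs_kernelH_le {φ ϱ : ℝ} (hφ : 0 ≤ φ) (hϱ : 0 ≤ ϱ) (t s : Set.Icc (0 : ℝ) T) :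
    |kernelH φ ϱ t s| ≤ φ * T + ϱ := by
  have ht := t.2.1
  have ht' := t.2.2
  have h1 : 0 ≤ φ * (T - t) := mul_nonneg hφ (by linarith)
  have h2 : 0 ≤ φ * t := mul_nonneg hφ ht
  unfold kernelH
  split_ifs
  · rw [abs_of_nonneg (by linarith)]
    linarith
  · rw [abs_zero]
    linarith

theorem admissibleKernel_kernelH {φ ϱ : ℝ} (hφ : 0 ≤ φ) (hϱ : 0 ≤ ϱ) :
    AdmissibleKernel (T := T) (kernelH φ ϱ) := by
  refine .of_bounded ?_ (abs_kernelH_le hφ hϱ)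
  unfold kernelH Function.uncurry
  refine Measurable.ite (measurableSet_lt measurable_snd measurable_fst) ?_ measurable_const
  fun_prop

theorem AdmissibleKernel.integrableOn_mul (hK : AdmissibleKernel K) {f : Set.Icc (0 : ℝ) T → ℝ}
    (hf : MemLp f 2 volume) (t : Set.Icc (0 : ℝ) T) :
    IntegrableOn (fun s => K t s * f s) (Set.Iic t) :=
  (hK.memLp t).integrable_mul (hf.restrict _)

theorem AdmissibleKernel.lintegral_enorm_mul_sq_le (hK : AdmissibleKernel K)
    {f : Set.Icc (0 : ℝ) T → ℝ} (hf : Measurable f) (t : Set.Icc (0 : ℝ) T) :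
    (∫⁻ s in Set.Iic t, ‖K t s * f s‖ₑ) ^ 2 ≤ kernelBound K * ∫⁻ s, ‖f s‖ₑ ^ 2 := by
  have h1 := ENNReal.lintegral_mul_le_Lp_mul_Lq (volume.restrict (Set.Iic t))
    Real.HolderConjugate.two_two (hK.measurable_left t).enorm.aemeasurable
    hf.enorm.aemeasurable
  have hsq : ∀ x : ℝ≥0∞, (x ^ (1 / 2 : ℝ)) ^ 2 = x := fun x => by
    rw [← ENNReal.rpow_natCast, ← ENNReal.rpow_mul]
    norm_num
  calc (∫⁻ s in Set.Iic t, ‖K t s * f s‖ₑ) ^ 2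
      ≤ ((∫⁻ s in Set.Iic t, ‖K t s‖ₑ ^ (2 : ℝ)) ^ (1 / 2 : ℝ)
        * (∫⁻ s in Set.Iic t, ‖f s‖ₑ ^ (2 : ℝ)) ^ (1 / 2 : ℝ)) ^ 2 := by
        gcongr
        simpa only [Pi.mul_apply, ← enorm_mul] using h1
    _ = (∫⁻ s in Set.Iic t, ‖K t s‖ₑ ^ 2) * ∫⁻ s in Set.Iic t, ‖f s‖ₑ ^ 2 := by
        rw [mul_pow, hsq, hsq]
        simp
    _ ≤ kernelBound K * ∫⁻ s, ‖f s‖ₑ ^ 2 :=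
        mul_le_mul' (le_iSup (fun t => ∫⁻ s in Set.Iic t, ‖K t s‖ₑ ^ 2) t)
          (setLIntegral_le_lintegral _ _)

variable {u : Set.Icc (0 : ℝ) T → Ω → ℝ}

theorem measurable_apply_left (hu : Measurable fun p : Set.Icc (0 : ℝ) T × Ω => u p.1 p.2) (ω : Ω) :
    Measurable fun t => u t ω :=
  hu.comp (measurable_id.prodMk measurable_const)

theorem measurable_apply_right (hu : Measurable fun p : Set.Icc (0 : ℝ) T × Ω => u p.1 p.2)
    (t : Set.Icc (0 : ℝ) T) : Measurable (u t) :=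
  hu.comp (measurable_const.prodMk measurable_id)

theorem enorm_volterraOp_sq_le (hK : AdmissibleKernel K)
    (hu : Measurable fun p : Set.Icc (0 : ℝ) T × Ω => u p.1 p.2) (t : Set.Icc (0 : ℝ) T) (ω : Ω) :
    ‖volterraOp K u t ω‖ₑ ^ 2 ≤ kernelBound K * ∫⁻ s, ‖u s ω‖ₑ ^ 2 :=
  le_trans (by gcongr; exact enorm_integral_le_lintegral_enorm _)
    (hK.lintegral_enorm_mul_sq_le (measurable_apply_left hu ω) t)

theorem measurable_volterraOp (hK : AdmissibleKernel K)
    (hu : Measurable fun p : Set.Icc (0 : ℝ) T × Ω => u p.1 p.2) :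
    Measurable fun p : Set.Icc (0 : ℝ) T × Ω => volterraOp K u p.1 p.2 := by
  have : (fun p : Set.Icc (0 : ℝ) T × Ω => volterraOp K u p.1 p.2)
      = fun p => ∫ s, {q : (Set.Icc (0 : ℝ) T × Ω) × Set.Icc (0 : ℝ) T | q.2 ≤ q.1.1}.indicator
        (fun q => K q.1.1 q.2 * u q.2 q.1.2) (p, s) := by
    ext p
    rw [volterraOp, ← integral_indicator measurableSet_Iic]
    rfl
  rw [this]
  refine (StronglyMeasurable.integral_prod_right' (Measurable.stronglyMeasurable ?_)).measurable
  refine Measurable.indicator ?_ (measurableSet_le measurable_snd measurable_fst.fst)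
  exact (hK.measurable.comp (measurable_fst.fst.prodMk measurable_snd)).mul
    (hu.comp (measurable_snd.prodMk measurable_fst.snd))

/-- `(𝐊u)_t` only involves `u s` with `s ≤ t`, and these are all constant on the atoms of `ℱ t`. -/
theorem progMeasurable_volterraOp [Countable Ω] {ℱ : Filtration (Set.Icc (0 : ℝ) T) mΩ}
    (hK : AdmissibleKernel K)
    (hu : Measurable[progSigma ℱ] fun p : Set.Icc (0 : ℝ) T × Ω => u p.1 p.2) :
    Measurable[progSigma ℱ] fun p : Set.Icc (0 : ℝ) T × Ω => volterraOp K u p.1 p.2 := by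
  obtain ⟨h1, h2⟩ := measurable_progSigma.1 hu
  refine measurable_progSigma.2 ⟨measurable_volterraOp hK h1, fun t => ?_⟩
  refine measurable_of_forall_measurableAtom fun ω ω' hω => ?_
  refine setIntegral_congr_fun measurableSet_Iic fun s hs => ?_
  have := eq_of_mem_measurableAtom (h2 s) (measurableAtom_anti (ℱ.mono hs) ω hω)
  simp only at this ⊢
  rw [this]

theorem lintegral_enorm_volterraOp_sq_le (hK : AdmissibleKernel K)
    (hu : Measurable fun p : Set.Icc (0 : ℝ) T × Ω => u p.1 p.2) (t : Set.Icc (0 : ℝ) T) :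
    ∫⁻ ω, ‖volterraOp K u t ω‖ₑ ^ 2 ∂P
      ≤ kernelBound K * ∫⁻ p : Set.Icc (0 : ℝ) T × Ω, ‖u p.1 p.2‖ₑ ^ 2 ∂(volume.prod P) := by
  rw [lintegral_prod_symm' _ (hu.enorm.pow_const 2),
    ← lintegral_const_mul _ (Measurable.lintegral_prod_left' (hu.enorm.pow_const 2))]
  exact lintegral_mono fun ω => enorm_volterraOp_sq_le hK hu t ω

theorem lintegral_enorm_sq_eq {α : Type*} [MeasurableSpace α] {μ : Measure α} {f : α → ℝ}
    (hf : MemLp f 2 μ) : ∫⁻ a, ‖f a‖ₑ ^ 2 ∂μ = ENNReal.ofReal (∫ a, f a ^ 2 ∂μ) := by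
  rw [ofReal_integral_eq_lintegral_ofReal hf.integrable_sq (ae_of_all _ fun a => sq_nonneg _)]
  refine lintegral_congr fun a => ?_
  rw [Real.enorm_eq_ofReal_abs, ← ENNReal.ofReal_pow (abs_nonneg _), sq_abs]

theorem memLp_two_of_lintegral {α : Type*} [MeasurableSpace α] {μ : Measure α} {f : α → ℝ}
    (hf : AEStronglyMeasurable f μ) (h : ∫⁻ a, ‖f a‖ₑ ^ 2 ∂μ < ∞) : MemLp f 2 μ := by
  refine ⟨hf, ?_⟩
  rw [eLpNorm_lt_top_iff_lintegral_rpow_enorm_lt_top (by simp) (by simp)]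
  simpa using h

/-- Cauchy–Schwarz along each path, then integration over `Ω`. The bound holds at every fixed time,
not only for almost every one, which is what the terminal inventory requires. -/
theorem memLp_volterraOp_apply (hK : AdmissibleKernel K)
    (hu : Measurable fun p : Set.Icc (0 : ℝ) T × Ω => u p.1 p.2)
    (hu2 : MemLp (fun p : Set.Icc (0 : ℝ) T × Ω => u p.1 p.2) 2 (volume.prod P))
    (t : Set.Icc (0 : ℝ) T) : MemLp (volterraOp K u t) 2 P ∧
      ∫ ω, volterraOp K u t ω ^ 2 ∂P
        ≤ (kernelBound K).toReal * ∫ p : Set.Icc (0 : ℝ) T × Ω, u p.1 p.2 ^ 2 ∂(volume.prod P) := by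
  have hle := lintegral_enorm_volterraOp_sq_le (P := P) hK hu t
  rw [lintegral_enorm_sq_eq hu2] at hle
  have h1 : MemLp (volterraOp K u t) 2 P :=
    memLp_two_of_lintegral
      (measurable_apply_right (measurable_volterraOp hK hu) t).aestronglyMeasurable
      (hle.trans_lt (ENNReal.mul_lt_top hK.bounded ENNReal.ofReal_lt_top))
  refine ⟨h1, ?_⟩
  rw [lintegral_enorm_sq_eq h1] at hle
  have hB : kernelBound K ≠ ∞ := hK.bounded.ne
  rw [← ENNReal.ofReal_toReal hB, ← ENNReal.ofReal_mul ENNReal.toReal_nonneg] at hle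
  exact (ENNReal.ofReal_le_ofReal_iff
    (mul_nonneg ENNReal.toReal_nonneg (integral_nonneg fun _ => sq_nonneg _))).1 hle

theorem memLp_volterraOp (hK : AdmissibleKernel K)
    (hu : Measurable fun p : Set.Icc (0 : ℝ) T × Ω => u p.1 p.2)
    (hu2 : MemLp (fun p : Set.Icc (0 : ℝ) T × Ω => u p.1 p.2) 2 (volume.prod P)) :
    MemLp (fun p : Set.Icc (0 : ℝ) T × Ω => volterraOp K u p.1 p.2) 2 (volume.prod P) := by
  refine memLp_two_of_lintegral (measurable_volterraOp hK hu).aestronglyMeasurable ?_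
  rw [lintegral_prod _ ((measurable_volterraOp hK hu).enorm.pow_const 2).aemeasurable]
  refine lt_of_le_of_lt (lintegral_mono fun t => lintegral_enorm_volterraOp_sq_le (P := P) hK hu t) ?_
  rw [lintegral_const, lintegral_enorm_sq_eq hu2]
  exact ENNReal.mul_lt_top (ENNReal.mul_lt_top hK.bounded ENNReal.ofReal_lt_top) (measure_lt_top _ _)

theorem integral_volterraOp_sq_le (hT : 0 < T) (hK : AdmissibleKernel K)
    (hu : Measurable fun p : Set.Icc (0 : ℝ) T × Ω => u p.1 p.2)
    (hu2 : MemLp (fun p : Set.Icc (0 : ℝ) T × Ω => u p.1 p.2) 2 (volume.prod P)) :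
    ∫ p : Set.Icc (0 : ℝ) T × Ω, volterraOp K u p.1 p.2 ^ 2 ∂(volume.prod P)
      ≤ T * (kernelBound K).toReal
        * ∫ p : Set.Icc (0 : ℝ) T × Ω, u p.1 p.2 ^ 2 ∂(volume.prod P) := by
  have hi := (memLp_volterraOp hK hu hu2).integrable_sq
  rw [integral_prod _ hi]
  refine (integral_mono hi.integral_prod_left (integrable_const _)
    fun t => (memLp_volterraOp_apply hK hu hu2 t).2).trans (le_of_eq ?_)
  rw [integral_const, measureReal_def, Measure.Subtype.volume_univ
    measurableSet_Icc.nullMeasurableSet, Real.volume_Icc, sub_zero, ENNReal.toReal_ofReal hT.le,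
    smul_eq_mul, mul_assoc]

theorem volterraOp_add_mul {Ω : Type*} {u v : Set.Icc (0 : ℝ) T → Ω → ℝ} (hK : AdmissibleKernel K) {ω : Ω}
    (hu : MemLp (fun t => u t ω) 2 volume) (hv : MemLp (fun t => v t ω) 2 volume) (ε : ℝ)
    (t : Set.Icc (0 : ℝ) T) :
    volterraOp K (fun s ω' => u s ω' + ε * v s ω') t ω
      = volterraOp K u t ω + ε * volterraOp K v t ω := by
  rw [volterraOp, volterraOp, volterraOp, ← integral_const_mul,
    ← integral_add (hK.integrableOn_mul hu t) ((hK.integrableOn_mul hv t).const_mul ε)]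
  exact integral_congr_ae (ae_of_all _ fun s => by ring)

theorem inventory_eq_add_volterraOp {Ω : Type*} {u : Set.Icc (0 : ℝ) T → Ω → ℝ} (X₀ : ℝ) (t : Set.Icc (0 : ℝ) T) (ω : Ω) :
    inventory X₀ u t ω = X₀ + volterraOp (fun _ _ => 1) u t ω := by
  simp [inventory, volterraOp]

end

section

/-! ### The space `L²` -/

theorem inner_toLp_eq_integral {α : Type*} [MeasurableSpace α] {μ : Measure α} {f g : α → ℝ}
    (hf : MemLp f 2 μ) (hg : MemLp g 2 μ) :
    inner ℝ (hf.toLp f) (hg.toLp g) = ∫ a, g a * f a ∂μ := by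
  rw [L2.inner_def]
  refine integral_congr_ae ?_
  filter_upwards [hf.coeFn_toLp, hg.coeFn_toLp] with a ha hb
  rw [ha, hb]
  rfl

theorem abs_integral_mul_le_sqrt {α : Type*} [MeasurableSpace α] {μ : Measure α} {f g : α → ℝ}
    (hf : MemLp f 2 μ) (hg : MemLp g 2 μ) :
    |∫ a, f a * g a ∂μ| ≤ √(∫ a, f a ^ 2 ∂μ) * √(∫ a, g a ^ 2 ∂μ) := by
  have h : ∀ {k : α → ℝ} (hk : MemLp k 2 μ), √(∫ a, k a ^ 2 ∂μ) = ‖hk.toLp k‖ := by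
    intro k hk
    rw [Real.sqrt_eq_iff_mul_self_eq (integral_nonneg fun _ => sq_nonneg _) (norm_nonneg _),
      ← sq, ← real_inner_self_eq_norm_sq, inner_toLp_eq_integral]
    simp only [sq]
  rw [← inner_toLp_eq_integral hg hf, h hf, h hg, mul_comm]
  exact abs_real_inner_le_norm _ _

/-! ### Weak sequential compactness -/

/-- Sequential Banach–Alaoglu in the dual of a separable space, transported to `H` by the Riesz
isomorphism. -/
theorem exists_weak_limit_hilbert {H : Type*} [NormedAddCommGroup H] [InnerProductSpace ℝ H]
    [CompleteSpace H] [TopologicalSpace.SeparableSpace H] {x : ℕ → H} {R : ℝ}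
    (hx : ∀ n, ‖x n‖ ≤ R) :
    ∃ φ : ℕ → ℕ, StrictMono φ ∧ ∃ a : H, ∀ y : H,
      Tendsto (fun k => inner ℝ (x (φ k)) y) atTop (𝓝 (inner ℝ a y)) := by
  obtain ⟨a, -, φ, hφ, h⟩ := WeakDual.isSeqCompact_closedBall ℝ H 0 R
    (x := fun n => StrongDual.toWeakDual (InnerProductSpace.toDual ℝ H (x n)))
    (fun n => by simpa using hx n)
  refine ⟨φ, hφ, (InnerProductSpace.toDual ℝ H).symm (WeakDual.toStrongDual a), fun y => ?_⟩
  have := ((WeakDual.eval_continuous y).tendsto a).comp h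
  rw [InnerProductSpace.toDual_symm_apply]
  exact this

theorem exists_weak_limit {α : Type*} {m m0 : MeasurableSpace α} [MeasurableSpace.CountablyGenerated α]
    (hm : m ≤ m0) {μ : Measure α} [IsFiniteMeasure μ] {f : ℕ → α → ℝ}
    (hf : ∀ n, Measurable[m] (f n)) (hf2 : ∀ n, MemLp (f n) 2 μ) {R : ℝ}
    (hR : ∀ n, ∫ a, f n a ^ 2 ∂μ ≤ R) :
    ∃ φ : ℕ → ℕ, StrictMono φ ∧ ∃ g : α → ℝ, Measurable[m] g ∧ MemLp g 2 μ ∧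
      ∀ ψ : α → ℝ, MemLp ψ 2 μ →
        Tendsto (fun k => ∫ a, ψ a * f (φ k) a ∂μ) atTop (𝓝 (∫ a, ψ a * g a ∂μ)) := by
  have : Fact ((2 : ℝ≥0∞) ≠ ∞) := ⟨by simp⟩
  obtain ⟨φ, hφ, a, ha⟩ := exists_weak_limit_hilbert (x := fun n => (hf2 n).toLp (f n))
    (R := √R) (fun n => by
      refine Real.le_sqrt_of_sq_le ?_
      rw [← real_inner_self_eq_norm_sq, inner_toLp_eq_integral]
      simpa only [sq] using hR n)
  have : Fact (m ≤ m0) := ⟨hm⟩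
  have hcomp : CompleteSpace (lpMeas ℝ ℝ m 2 μ) := inferInstance
  have hmem : ∀ n, (hf2 n).toLp (f n) ∈ lpMeas ℝ ℝ m 2 μ := fun n =>
    mem_lpMeas_iff_aestronglyMeasurable.2
      ⟨f n, @Measurable.stronglyMeasurable _ _ _ m _ _ _ _ _ (hf n), (hf2 n).coeFn_toLp⟩
  have haK : a ∈ lpMeas ℝ ℝ m 2 μ := by
    -- The closed subspace of `m`-measurable classes is its own double orthogonal complement, and
    -- orthogonality to a fixed vector survives weak limits.
    rw [← Submodule.orthogonal_orthogonal (lpMeas ℝ ℝ m 2 μ)]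
    refine (Submodule.mem_orthogonal' _ _).2 fun y hy => ?_
    refine tendsto_nhds_unique (ha y) ?_
    simp only [fun k => (Submodule.mem_orthogonal _ _).1 hy _ (hmem (φ k))]
    exact tendsto_const_nhds
  obtain ⟨g, hg, hag⟩ := mem_lpMeas_iff_aestronglyMeasurable.1 haK
  have hg2 : MemLp g 2 μ := (memLp_congr_ae hag).1 (Lp.memLp a)
  refine ⟨φ, hφ, g, hg.measurable, hg2, fun ψ hψ => ?_⟩
  have hga : hg2.toLp g = a := by
    refine Lp.ext ?_
    filter_upwards [hg2.coeFn_toLp, hag] with x h1 h2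
    rw [h1, h2]
  have := ha (hψ.toLp ψ)
  rw [← hga] at this
  simpa only [inner_toLp_eq_integral] using this

/-! ### Convergence of integrals -/

/-- A Vitali-type theorem: `|f n|` need only be dominated up to `δ b n`, with `b n` bounded in `L¹`.
The excess `max (|f n| - δ b n) 0` is dominated by `|D|` and tends to zero; the remainder costs at
most `δ B`. -/
theorem tendsto_integral_of_dominated_up_to {α : Type*} [MeasurableSpace α] {μ : Measure α}
    {f b : ℕ → α → ℝ} (hf : ∀ n, Integrable (f n) μ) (hb : ∀ n, Integrable (b n) μ)
    (hb0 : ∀ n a, 0 ≤ b n a) {B : ℝ} (hB : ∀ n, ∫ a, b n a ∂μ ≤ B)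
    (hlim : ∀ᵐ a ∂μ, Tendsto (fun n => f n a) atTop (𝓝 0))
    (hdom : ∀ δ > 0, ∃ D : α → ℝ, Integrable D μ ∧ ∀ n, ∀ᵐ a ∂μ, |f n a| ≤ δ * b n a + D a) :
    Tendsto (fun n => ∫ a, |f n a| ∂μ) atTop (𝓝 0) := by
  have hB0 : 0 ≤ B := (integral_nonneg (hb0 0)).trans (hB 0)
  rw [Metric.tendsto_atTop]
  intro ε hε
  obtain ⟨δ, hδ, hδB⟩ : ∃ δ > 0, δ * B < ε / 2 := by
    -- Dividing by `B + 1` covers the case `B = 0`.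
    refine ⟨ε / 2 / (B + 1), by positivity, ?_⟩
    rw [div_mul_eq_mul_div, div_lt_iff₀ (by positivity)]
    nlinarith
  obtain ⟨D, hD, hfD⟩ := hdom δ hδ
  have hgi : ∀ n, Integrable (fun a => max (|f n a| - δ * b n a) 0) μ := fun n =>
    ((hf n).abs.sub ((hb n).const_mul δ)).sup (integrable_zero _ _ _)
  have hg : Tendsto (fun n => ∫ a, max (|f n a| - δ * b n a) 0 ∂μ) atTop (𝓝 (∫ a, (0 : ℝ) ∂μ)) := by
    refine tendsto_integral_of_dominated_convergence (fun a => |D a|)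
      (fun n => (hgi n).aestronglyMeasurable) hD.abs (fun n => ?_) ?_
    · filter_upwards [hfD n] with a ha
      rw [Real.norm_eq_abs, abs_of_nonneg (le_max_right _ _)]
      exact max_le (by linarith [le_abs_self (D a)]) (abs_nonneg _)
    · filter_upwards [hlim] with a ha
      refine squeeze_zero (fun n => le_max_right _ _) (fun n => ?_) (by simpa using ha.abs)
      exact max_le (by linarith [mul_nonneg hδ.le (hb0 n a)]) (abs_nonneg _)
  rw [integral_zero, Metric.tendsto_atTop] at hg
  obtain ⟨N, hN⟩ := hg (ε / 2) (half_pos hε)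
  refine ⟨N, fun n hn => ?_⟩
  have h1 : ∫ a, |f n a| ∂μ ≤ ∫ a, (max (|f n a| - δ * b n a) 0 + δ * b n a) ∂μ :=
    integral_mono (hf n).abs ((hgi n).add ((hb n).const_mul δ)) fun a => by
      have := le_max_left (|f n a| - δ * b n a) 0
      simp only
      linarith
  rw [integral_add (hgi n) ((hb n).const_mul δ), integral_const_mul] at h1
  have h2 := hN n hn
  rw [Real.dist_eq, sub_zero] at h2 ⊢
  rw [abs_of_nonneg (integral_nonneg fun a => abs_nonneg _)]
  have h3 := le_abs_self (∫ a, max (|f n a| - δ * b n a) 0 ∂μ)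
  have h4 := mul_le_mul_of_nonneg_left (hB n) hδ.le
  linarith

/-- Bounded in `L²` and null in the limit a.e. implies weakly null. Young's inequality `|x y| ≤ δ y²
+ x²/(4δ)` provides the domination up to `δ`. -/
theorem tendsto_integral_mul_of_tendsto_ae {α : Type*} [MeasurableSpace α] {μ : Measure α}
    {x : α → ℝ} {y : ℕ → α → ℝ} (hx : MemLp x 2 μ) (hy : ∀ n, MemLp (y n) 2 μ) {B : ℝ}
    (hB : ∀ n, ∫ a, y n a ^ 2 ∂μ ≤ B) (hlim : ∀ᵐ a ∂μ, Tendsto (fun n => y n a) atTop (𝓝 0)) :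
    Tendsto (fun n => ∫ a, x a * y n a ∂μ) atTop (𝓝 0) := by
  refine squeeze_zero_norm (fun n => norm_integral_le_integral_norm _) ?_
  refine tendsto_integral_of_dominated_up_to (b := fun n a => y n a ^ 2)
    (fun n => hx.integrable_mul (hy n)) (fun n => (hy n).integrable_sq)
    (fun n a => sq_nonneg _) hB ?_ fun δ hδ => ⟨fun a => 1 / (4 * δ) * x a ^ 2,
      hx.integrable_sq.const_mul _, fun n => ae_of_all _ fun a => ?_⟩
  · filter_upwards [hlim] with a ha
    simpa using ha.const_mul (x a)
  · have h1 : 0 ≤ (2 * δ * |y n a| - |x a|) ^ 2 / (4 * δ) := by positivity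
    have h2 : (2 * δ * |y n a| - |x a|) ^ 2 / (4 * δ)
        = δ * |y n a| ^ 2 + 1 / (4 * δ) * |x a| ^ 2 - |x a| * |y n a| := by
      field_simp
      ring
    rw [sq_abs, sq_abs] at h2
    rw [abs_mul]
    linarith

end

section

variable {T : ℝ} {Ω : Type*} [mΩ : MeasurableSpace Ω] {P : Measure Ω} [IsProbabilityMeasure P]
  {ℱ : Filtration (Set.Icc (0 : ℝ) T) mΩ}

/-! ### Growth of `h` -/

/-- Since `y ^ (ζ - 1) → 0` at infinity, `y ^ ζ ≤ δ y` beyond some `k`, while `k ^ ζ` bounds the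
rest. An arbitrarily small factor before `x ^ 2` is needed both for coercivity and for strong
convergence of `h(Z)`. -/
theorem StrictlySublinear.sq_le {h : ℝ → ℝ} (hsub : StrictlySublinear h) {ε : ℝ} (hε : 0 < ε) :
    ∃ M : ℝ, 0 ≤ M ∧ ∀ x, h x ^ 2 ≤ ε * x ^ 2 + M := by
  obtain ⟨ζ, hζ0, hζ1, C, hC⟩ := hsub
  have hC0 : 0 ≤ C := by
    have := (abs_nonneg _).trans (hC 0)
    rwa [abs_zero, Real.zero_rpow hζ0.ne', add_zero, mul_one] at this
  obtain ⟨δ, hδ, hδε⟩ : ∃ δ > 0, 2 * (C * δ) ^ 2 ≤ ε := by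
    -- Squaring a sum of two terms costs a factor `2`, so `C δ ≤ √(ε/2)` is required; `C + 1` guards
    -- against `C = 0`.
    refine ⟨√(ε / 2) / (C + 1), by positivity, ?_⟩
    have h1 : C * (√(ε / 2) / (C + 1)) ≤ √(ε / 2) := by
      rw [mul_div_assoc', div_le_iff₀ (by positivity)]
      nlinarith [Real.sqrt_nonneg (ε / 2)]
    have h2 := pow_le_pow_left₀ (by positivity) h1 2
    rw [Real.sq_sqrt (by positivity)] at h2
    linarith
  obtain ⟨y₀, hy₀⟩ := ((tendsto_rpow_neg_atTop (sub_pos.2 hζ1)).eventually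
    (gt_mem_nhds hδ)).exists_forall_of_atTop
  set k := max y₀ 1
  have hrpow : ∀ y : ℝ, 0 ≤ y → y ^ ζ ≤ δ * y + k ^ ζ := by
    intro y hy
    rcases le_total k y with hky | hky
    · have hy1 : 0 < y := lt_of_lt_of_le one_pos ((le_max_right _ _).trans hky)
      have h1 := (hy₀ y ((le_max_left _ _).trans hky)).le
      have h2 : y ^ ζ = y ^ (-(1 - ζ)) * y := by
        rw [← Real.rpow_add_one hy1.ne']
        congr 1
        ring
      rw [h2]
      have h3 : 0 ≤ k ^ ζ := Real.rpow_nonneg (zero_le_one.trans (le_max_right _ _)) _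
      nlinarith
    · have := Real.rpow_le_rpow hy hky hζ0.le
      nlinarith
  refine ⟨2 * (C * (1 + k ^ ζ)) ^ 2, by positivity, fun x => ?_⟩
  have h1 : |h x| ≤ C * δ * |x| + C * (1 + k ^ ζ) := by
    refine (hC x).trans ?_
    have := mul_le_mul_of_nonneg_left (hrpow |x| (abs_nonneg x)) hC0
    linarith
  calc h x ^ 2 = |h x| ^ 2 := (sq_abs _).symm
    _ ≤ (C * δ * |x| + C * (1 + k ^ ζ)) ^ 2 := pow_le_pow_left₀ (abs_nonneg _) h1 2
    _ ≤ 2 * (C * δ * |x|) ^ 2 + 2 * (C * (1 + k ^ ζ)) ^ 2 := by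
        nlinarith [sq_nonneg (C * δ * |x| - C * (1 + k ^ ζ))]
    _ = 2 * (C * δ) ^ 2 * x ^ 2 + 2 * (C * (1 + k ^ ζ)) ^ 2 := by
        rw [mul_pow _ |x|, sq_abs]
        ring
    _ ≤ _ := by
        gcongr

theorem memLp_comp_lipschitz {α : Type*} [MeasurableSpace α] {μ : Measure α} [IsFiniteMeasure μ]
    {h : ℝ → ℝ} {L : NNReal} (hL : LipschitzWith L h) {f : α → ℝ} (hf : MemLp f 2 μ) :
    MemLp (fun a => h (f a)) 2 μ := by
  refine ((hf.norm.const_mul (L : ℝ)).add (memLp_const |h 0|)).mono'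
    (hL.continuous.comp_aestronglyMeasurable hf.aestronglyMeasurable) (ae_of_all _ fun a => ?_)
  have := hL.dist_le_mul (f a) 0
  rw [Real.dist_eq, Real.dist_eq, sub_zero] at this
  simp only [Pi.add_apply, Real.norm_eq_abs]
  calc |h (f a)| = |h (f a) - h 0 + h 0| := by rw [sub_add_cancel]
    _ ≤ |h (f a) - h 0| + |h 0| := abs_add_le _ _
    _ ≤ _ := by linarith

/-! ### The alpha signal -/

theorem lintegral_enorm_condExp_sq_le {α : Type*} {m m0 : MeasurableSpace α} {μ : Measure α}
    (X : α → ℝ) : ∫⁻ a, ‖(μ[X | m]) a‖ₑ ^ 2 ∂μ ≤ ∫⁻ a, ‖X a‖ₑ ^ 2 ∂μ := by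
  have h1 := eLpNorm_condExp_le_eLpNorm (m := m) (μ := μ) X (p := 2) (by norm_num)
  rw [eLpNorm_eq_lintegral_rpow_enorm_toReal (by norm_num) (by norm_num),
    eLpNorm_eq_lintegral_rpow_enorm_toReal (by norm_num) (by norm_num)] at h1
  simpa using (ENNReal.rpow_le_rpow_iff (by norm_num)).1 h1

theorem progMeasurable_atomAverage [Countable Ω] [DiscreteMeasurableSpace Ω]
    {w : Set.Icc (0 : ℝ) T → Ω → ℝ} (hw : Measurable fun p : Set.Icc (0 : ℝ) T × Ω => w p.1 p.2) :
    Measurable[progSigma ℱ] fun p : Set.Icc (0 : ℝ) T × Ω =>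
      atomAverage (ℱ p.1) P (w p.1) p.2 := by
  refine measurable_progSigma.2 ⟨?_, fun t => ?_⟩
  · have h : Measurable fun p : Set.Icc (0 : ℝ) T × Ω => ((p.1, p.1), p.2) := by fun_prop
    have h' := Measurable.comp (measurable_atomAverage (P := P) ℱ hw) h
    simpa only [Function.comp_def] using h'
  · refine measurable_of_forall_measurableAtom fun ω ω' h => ?_
    show atomAverage (ℱ t) P (w t) ω' = atomAverage (ℱ t) P (w t) ω
    exact atomAverage_eq_of_mem h

theorem memLp_atomAverage [Countable Ω] [DiscreteMeasurableSpace Ω]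
    {w : Set.Icc (0 : ℝ) T → Ω → ℝ} (hw : Measurable fun p : Set.Icc (0 : ℝ) T × Ω => w p.1 p.2)
    (hw2 : MemLp (fun p : Set.Icc (0 : ℝ) T × Ω => w p.1 p.2) 2 (volume.prod P)) :
    MemLp (fun p : Set.Icc (0 : ℝ) T × Ω => atomAverage (ℱ p.1) P (w p.1) p.2) 2
      (volume.prod P) := by
  have ham := (measurable_progSigma.1 (progMeasurable_atomAverage (ℱ := ℱ) (P := P) hw)).1
  have hi := hw2.integrable (by norm_num)
  refine memLp_two_of_lintegral ham.aestronglyMeasurable ?_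
  rw [lintegral_prod _ (ham.enorm.pow_const 2).aemeasurable]
  refine lt_of_le_of_lt (lintegral_mono_ae (g := fun t => ∫⁻ ω, ‖w t ω‖ₑ ^ 2 ∂P) ?_) ?_
  · filter_upwards [hi.prod_right_ae] with t ht
    refine le_trans (le_of_eq (lintegral_congr_ae ?_))
      (lintegral_enorm_condExp_sq_le (m := ℱ t) (w t))
    filter_upwards [ae_singleton_ne_zero P] with ω hω
    rw [condExp_eq_atomAverage (ℱ.le t) ht hω]
  · have h := lintegral_enorm_sq_eq hw2
    rw [lintegral_prod _ (hw.enorm.pow_const 2).aemeasurable] at h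
    rw [h]
    exact ENNReal.ofReal_lt_top

/-- The signal is defined through a separate conditional expectation at each time, so its
measurability in `(t, ω)` is not given. The atom average is measurable, inherits the `L²`
contraction at almost every time, and agrees with the signal wherever `P {ω} > 0` and the
conditioned variable is integrable. -/
theorem exists_alphaSignal_version [Countable Ω] [DiscreteMeasurableSpace Ω] (hT : 0 < T)
    {S : Set.Icc (0 : ℝ) T → Ω → ℝ} (hS : MemL2 ℱ P S) (hST : MemLp (S (endTime hT)) 2 P) :
    ∃ a : Set.Icc (0 : ℝ) T × Ω → ℝ, Measurable[progSigma ℱ] a ∧ MemLp a 2 (volume.prod P) ∧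
      ∀ᵐ p ∂(volume.prod P), alphaSignal hT ℱ P S p.1 p.2 = a p := by
  obtain ⟨hSm, hS2⟩ := (memL2_iff hT).1 hS
  replace hSm := (measurable_progSigma.1 hSm).1
  have hwm : Measurable fun p : Set.Icc (0 : ℝ) T × Ω => S (endTime hT) p.2 - S p.1 p.2 :=
    ((measurable_apply_right hSm _).comp measurable_snd).sub hSm
  have hw2 : MemLp (fun p : Set.Icc (0 : ℝ) T × Ω => S (endTime hT) p.2 - S p.1 p.2) 2
    (volume.prod P) := (hST.comp_snd volume).sub hS2
  refine ⟨_, progMeasurable_atomAverage (P := P) (w := fun t ω => S (endTime hT) ω - S t ω) hwm,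
    memLp_atomAverage (w := fun t ω => S (endTime hT) ω - S t ω) hwm hw2, ?_⟩
  have h1 : ∀ᵐ p : Set.Icc (0 : ℝ) T × Ω ∂(volume.prod P),
      Integrable (fun ω => S (endTime hT) ω - S p.1 ω) P :=
    Measure.quasiMeasurePreserving_fst.ae (hw2.integrable (by norm_num)).prod_right_ae
  filter_upwards [h1, ae_prod_singleton_ne_zero P] with p hp hp'
  exact condExp_eq_atomAverage (ℱ.le p.1) hp hp'

/-! ### The performance functional as an integral over `[0,T] × Ω` -/

variable {G : Set.Icc (0 : ℝ) T → Set.Icc (0 : ℝ) T → ℝ} {g u : Set.Icc (0 : ℝ) T → Ω → ℝ}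

theorem measurable_distortion (hG : AdmissibleKernel G)
    (hg : Measurable fun p : Set.Icc (0 : ℝ) T × Ω => g p.1 p.2)
    (hu : Measurable fun p : Set.Icc (0 : ℝ) T × Ω => u p.1 p.2) :
    Measurable fun p : Set.Icc (0 : ℝ) T × Ω => distortion G g u p.1 p.2 :=
  hg.add (measurable_volterraOp hG hu)

theorem memLp_distortion (hG : AdmissibleKernel G)
    (hg : MemLp (fun p : Set.Icc (0 : ℝ) T × Ω => g p.1 p.2) 2 (volume.prod P))
    (hu : Measurable fun p : Set.Icc (0 : ℝ) T × Ω => u p.1 p.2)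
    (hu2 : MemLp (fun p : Set.Icc (0 : ℝ) T × Ω => u p.1 p.2) 2 (volume.prod P)) :
    MemLp (fun p : Set.Icc (0 : ℝ) T × Ω => distortion G g u p.1 p.2) 2 (volume.prod P) :=
  hg.add (memLp_volterraOp hG hu hu2)

theorem memLp_inventory (X₀ : ℝ)
    (hu : Measurable fun p : Set.Icc (0 : ℝ) T × Ω => u p.1 p.2)
    (hu2 : MemLp (fun p : Set.Icc (0 : ℝ) T × Ω => u p.1 p.2) 2 (volume.prod P)) :
    MemLp (fun p : Set.Icc (0 : ℝ) T × Ω => inventory X₀ u p.1 p.2) 2 (volume.prod P) := by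
  simp only [inventory_eq_add_volterraOp]
  exact (memLp_const X₀).add (memLp_volterraOp admissibleKernel_one hu hu2)

theorem memLp_inventory_apply (X₀ : ℝ)
    (hu : Measurable fun p : Set.Icc (0 : ℝ) T × Ω => u p.1 p.2)
    (hu2 : MemLp (fun p : Set.Icc (0 : ℝ) T × Ω => u p.1 p.2) 2 (volume.prod P))
    (t : Set.Icc (0 : ℝ) T) : MemLp (inventory X₀ u t) 2 P := by
  have : inventory X₀ u t = fun ω => X₀ + volterraOp (fun _ _ => 1) u t ω :=
    funext fun ω => inventory_eq_add_volterraOp X₀ t ω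
  rw [this]
  exact (memLp_const X₀).add (memLp_volterraOp_apply admissibleKernel_one hu hu2 t).1

theorem performanceWellDefined [Countable Ω] [DiscreteMeasurableSpace Ω] (hT : 0 < T) (γ X₀ : ℝ)
    {h : ℝ → ℝ} {L : NNReal} (hL : LipschitzWith L h) (hG : AdmissibleKernel G)
    {S : Set.Icc (0 : ℝ) T → Ω → ℝ} (hS : MemL2 ℱ P S) (hST : MemLp (S (endTime hT)) 2 P)
    (hg : MemL2 ℱ P g) (hu : MemL2 ℱ P u) :
    PerformanceWellDefined hT ℱ P γ X₀ h G S g u := by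
  obtain ⟨hum, hu2⟩ := (memL2_iff hT).1 hu
  replace hum := (measurable_progSigma.1 hum).1
  obtain ⟨a, -, ha2, haeq⟩ := exists_alphaSignal_version hT hS hST
  refine ⟨?_, (memLp_inventory X₀ hum hu2).integrable_sq,
    (memLp_inventory_apply X₀ hum hu2 _).integrable_sq⟩
  have hα : MemLp (fun p : Set.Icc (0 : ℝ) T × Ω => alphaSignal hT ℱ P S p.1 p.2) 2
    (volume.prod P) := (memLp_congr_ae haeq).2 ha2
  exact (hα.sub ((hu2.const_mul (γ / 2)).add
    (memLp_comp_lipschitz hL (memLp_distortion hG hg.2 hum hu2)))).integrable_mul hu2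

theorem performance_eq [Countable Ω] [DiscreteMeasurableSpace Ω] (hT : 0 < T) (γ φ ϱ X₀ : ℝ)
    {h : ℝ → ℝ} {L : NNReal} (hL : LipschitzWith L h) (hG : AdmissibleKernel G)
    {S : Set.Icc (0 : ℝ) T → Ω → ℝ} (hS : MemL2 ℱ P S) (hST : MemLp (S (endTime hT)) 2 P)
    (hg : MemL2 ℱ P g) (hu : MemL2 ℱ P u)
    {a : Set.Icc (0 : ℝ) T × Ω → ℝ} (ha2 : MemLp a 2 (volume.prod P))
    (ha : ∀ᵐ p ∂(volume.prod P), alphaSignal hT ℱ P S p.1 p.2 = a p) :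
    performance hT ℱ P γ φ ϱ X₀ h G S g u
      = ∫ p : Set.Icc (0 : ℝ) T × Ω, a p * u p.1 p.2 ∂(volume.prod P)
        - γ / 2 * ∫ p : Set.Icc (0 : ℝ) T × Ω, u p.1 p.2 ^ 2 ∂(volume.prod P)
        - ∫ p : Set.Icc (0 : ℝ) T × Ω, h (distortion G g u p.1 p.2) * u p.1 p.2 ∂(volume.prod P)
        - φ / 2 * ∫ p : Set.Icc (0 : ℝ) T × Ω, inventory X₀ u p.1 p.2 ^ 2 ∂(volume.prod P)
        - ϱ / 2 * ∫ ω, inventory X₀ u (endTime hT) ω ^ 2 ∂P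
        + X₀ * ∫ ω, S (endTime hT) ω ∂P := by
  obtain ⟨h1, h2, h3⟩ := performanceWellDefined hT γ X₀ hL hG hS hST hg hu
  obtain ⟨hum, hu2⟩ := (memL2_iff hT).1 hu
  replace hum := (measurable_progSigma.1 hum).1
  have hh := memLp_comp_lipschitz hL (memLp_distortion hG hg.2 hum hu2)
  have e1 : ∫ p : Set.Icc (0 : ℝ) T × Ω,
      (alphaSignal hT ℱ P S p.1 p.2 - impactCost γ h G g u p.1 p.2) * u p.1 p.2 ∂(volume.prod P)
      = ∫ p : Set.Icc (0 : ℝ) T × Ω, a p * u p.1 p.2 ∂(volume.prod P)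
        - γ / 2 * ∫ p : Set.Icc (0 : ℝ) T × Ω, u p.1 p.2 ^ 2 ∂(volume.prod P)
        - ∫ p : Set.Icc (0 : ℝ) T × Ω,
            h (distortion G g u p.1 p.2) * u p.1 p.2 ∂(volume.prod P) := by
    have i1 : Integrable (fun p : Set.Icc (0 : ℝ) T × Ω => a p * u p.1 p.2) (volume.prod P) :=
      ha2.integrable_mul hu2
    have i2 : Integrable (fun p : Set.Icc (0 : ℝ) T × Ω => γ / 2 * u p.1 p.2 ^ 2)
      (volume.prod P) := hu2.integrable_sq.const_mul _
    have i3 : Integrable (fun p : Set.Icc (0 : ℝ) T × Ω =>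
      h (distortion G g u p.1 p.2) * u p.1 p.2) (volume.prod P) := hh.integrable_mul hu2
    have i12 : Integrable (fun p : Set.Icc (0 : ℝ) T × Ω =>
      a p * u p.1 p.2 - γ / 2 * u p.1 p.2 ^ 2) (volume.prod P) := i1.sub i2
    rw [← integral_const_mul, ← integral_sub i1 i2, ← integral_sub i12 i3]
    refine integral_congr_ae ?_
    filter_upwards [ha] with p hp
    rw [hp, impactCost]
    ring
  rw [performance, integral_sub, integral_sub, integral_const_mul, integral_const_mul,
    ← integral_prod_symm _ h1, ← integral_prod_symm _ h2, e1]
  · exact h1.integral_prod_right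
  · exact h2.integral_prod_right.const_mul _
  · exact h1.integral_prod_right.sub (h2.integral_prod_right.const_mul _)
  · exact h3.const_mul _

end

section

variable {T : ℝ} {Ω : Type*} [mΩ : MeasurableSpace Ω] {P : Measure Ω} [IsProbabilityMeasure P]
  {ℱ : Filtration (Set.Icc (0 : ℝ) T) mΩ} {K G : Set.Icc (0 : ℝ) T → Set.Icc (0 : ℝ) T → ℝ}
  {g v : Set.Icc (0 : ℝ) T → Ω → ℝ} {u : ℕ → Set.Icc (0 : ℝ) T → Ω → ℝ}

/-! ### Existence of a maximizer -/

/-- The representer is `K(t,s) 1_{s ≤ t} 1_{ω' = ω} / P {ω}`. It lies in `L²` because `ω` carries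
mass, and it turns weak convergence of controls into pointwise convergence of their Volterra
transforms. -/
theorem integral_representer_mul [DiscreteMeasurableSpace Ω] (hK : AdmissibleKernel K)
    (t : Set.Icc (0 : ℝ) T) {ω : Ω} (hω : P {ω} ≠ 0) :
    ∃ ψ : Set.Icc (0 : ℝ) T × Ω → ℝ, MemLp ψ 2 (volume.prod P) ∧
      ∀ w : Set.Icc (0 : ℝ) T → Ω → ℝ,
        MemLp (fun p : Set.Icc (0 : ℝ) T × Ω => w p.1 p.2) 2 (volume.prod P) →
        ∫ p : Set.Icc (0 : ℝ) T × Ω, ψ p * w p.1 p.2 ∂(volume.prod P) = volterraOp K w t ω := by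
  have hKt : MemLp ((Set.Iic t).indicator (K t)) 2 volume :=
    (memLp_indicator_iff_restrict measurableSet_Iic).2 (hK.memLp t)
  have hψ : MemLp (fun p : Set.Icc (0 : ℝ) T × Ω =>
      (Set.univ ×ˢ {ω}).indicator (fun p => (P.real {ω})⁻¹ * (Set.Iic t).indicator (K t) p.1) p) 2
      (volume.prod P) :=
    ((hKt.comp_fst P).const_mul _).indicator (MeasurableSet.univ.prod (measurableSet_singleton ω))
  refine ⟨_, hψ, fun w hw => ?_⟩
  have hP : P.real {ω} ≠ 0 := (measureReal_ne_zero_iff (measure_ne_top P _)).2 hω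
  have hi : Integrable (fun p : Set.Icc (0 : ℝ) T × Ω =>
      (Set.univ ×ˢ {ω}).indicator (fun p => (P.real {ω})⁻¹ * (Set.Iic t).indicator (K t) p.1) p
        * w p.1 p.2) (volume.prod P) := hψ.integrable_mul hw
  rw [integral_prod_symm _ hi]
  have : ∀ ω' : Ω, ∫ s : Set.Icc (0 : ℝ) T, (Set.univ ×ˢ {ω}).indicator
      (fun p : Set.Icc (0 : ℝ) T × Ω => (P.real {ω})⁻¹ * (Set.Iic t).indicator (K t) p.1) (s, ω')
        * w s ω'
      = ({ω} : Set Ω).indicator (fun ω' => (P.real {ω})⁻¹ * volterraOp K w t ω') ω' := by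
    intro ω'
    by_cases h : ω' = ω
    · rw [Set.indicator_of_mem (by simpa using h), volterraOp,
        ← integral_indicator measurableSet_Iic, ← integral_const_mul]
      refine integral_congr_ae (ae_of_all _ fun s => ?_)
      simp only [h, Set.indicator, Set.mem_prod, Set.mem_univ, Set.mem_singleton_iff, true_and,
        if_true]
      split_ifs <;> ring
    · simp [Set.indicator, h]
  simp only [this]
  rw [integral_indicator (measurableSet_singleton ω), integral_singleton, smul_eq_mul,
    mul_inv_cancel_left₀ hP]

/-- Strong times weak: `h ∘ z n` converges to `h ∘ z₀` in `L²` norm, and what is left is the weak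
convergence of `y n` tested against `h ∘ z₀`. Mere boundedness of `z n` in `L²` suffices for the
first because `h` is sublinear. -/
theorem tendsto_integral_comp_mul {α : Type*} [MeasurableSpace α] {μ : Measure α}
    [IsFiniteMeasure μ] {h : ℝ → ℝ} {L : NNReal} (hL : LipschitzWith L h) (hsub : StrictlySublinear h)
    {z y : ℕ → α → ℝ} {z₀ y₀ : α → ℝ} (hz : ∀ n, MemLp (z n) 2 μ) (hz₀ : MemLp z₀ 2 μ)
    (hy : ∀ n, MemLp (y n) 2 μ) {B : ℝ} (hzB : ∀ n, ∫ a, z n a ^ 2 ∂μ ≤ B)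
    (hyB : ∀ n, ∫ a, y n a ^ 2 ∂μ ≤ B)
    (hlim : ∀ᵐ a ∂μ, Tendsto (fun n => z n a) atTop (𝓝 (z₀ a)))
    (hweak : ∀ ψ : α → ℝ, MemLp ψ 2 μ →
      Tendsto (fun n => ∫ a, ψ a * y n a ∂μ) atTop (𝓝 (∫ a, ψ a * y₀ a ∂μ))) :
    Tendsto (fun n => ∫ a, h (z n a) * y n a ∂μ) atTop (𝓝 (∫ a, h (z₀ a) * y₀ a ∂μ)) := by
  have hh := fun n => memLp_comp_lipschitz hL (hz n)
  have hh₀ := memLp_comp_lipschitz hL hz₀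
  have hd : ∀ n, MemLp (fun a => h (z n a) - h (z₀ a)) 2 μ := fun n => (hh n).sub hh₀
  have hstrong : Tendsto (fun n => ∫ a, |(h (z n a) - h (z₀ a)) ^ 2| ∂μ) atTop (𝓝 0) := by
    refine tendsto_integral_of_dominated_up_to (b := fun n a => z n a ^ 2)
      (fun n => (hd n).integrable_sq) (fun n => (hz n).integrable_sq) (fun n a => sq_nonneg _) hzB
      ?_ fun δ hδ => ?_
    · filter_upwards [hlim] with a ha
      have h1 := ((hL.continuous.tendsto (z₀ a)).comp ha).sub_const (h (z₀ a))
      simpa using h1.pow 2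
    -- The square of the difference is at most `2 h(z n)² + 2 h(z₀)²`, so `δ/2` in the growth bound
    -- gives exactly `δ (z n)²`.
    · obtain ⟨M, -, hM⟩ := hsub.sq_le (half_pos hδ)
      refine ⟨fun a => 2 * M + 2 * h (z₀ a) ^ 2,
        (integrable_const _).add (hh₀.integrable_sq.const_mul 2), fun n => ae_of_all _ fun a => ?_⟩
      rw [abs_of_nonneg (sq_nonneg _)]
      nlinarith [hM (z n a), sq_nonneg (h (z n a) + h (z₀ a))]
  simp only [abs_sq] at hstrong
  have h1 : Tendsto (fun n => ∫ a, (h (z n a) - h (z₀ a)) * y n a ∂μ) atTop (𝓝 0) := by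
    refine squeeze_zero_norm (a := fun n => √(∫ a, (h (z n a) - h (z₀ a)) ^ 2 ∂μ) * √B)
      (fun n => (abs_integral_mul_le_sqrt (hd n) (hy n)).trans ?_) ?_
    · exact mul_le_mul_of_nonneg_left (Real.sqrt_le_sqrt (hyB n)) (Real.sqrt_nonneg _)
    · simpa using (hstrong.sqrt).mul_const √B
  have h2 := h1.add (hweak _ hh₀)
  rw [zero_add] at h2
  refine h2.congr fun n => ?_
  have i1 : Integrable (fun a => (h (z n a) - h (z₀ a)) * y n a) μ := (hd n).integrable_mul (hy n)
  have i2 : Integrable (fun a => h (z₀ a) * y n a) μ := hh₀.integrable_mul (hy n)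
  rw [← integral_add i1 i2]
  exact integral_congr_ae (ae_of_all _ fun a => by ring)

/-- Convexity of the square. The lower bound is affine in `y`, so it passes to weak limits where the
square itself need not. -/
theorem integral_sq_ge_tangent {α : Type*} [MeasurableSpace α] {μ : Measure α} {x y : α → ℝ}
    (hx : MemLp x 2 μ) (hy : MemLp y 2 μ) :
    ∫ a, x a ^ 2 ∂μ + 2 * ∫ a, x a * (y a - x a) ∂μ ≤ ∫ a, y a ^ 2 ∂μ := by
  have i1 : Integrable (fun a => x a * (y a - x a)) μ := hx.integrable_mul (hy.sub hx)
  rw [← integral_const_mul, ← integral_add hx.integrable_sq (i1.const_mul 2)]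
  refine integral_mono (hx.integrable_sq.add (i1.const_mul 2)) hy.integrable_sq fun a => ?_
  simp only
  nlinarith [sq_nonneg (y a - x a)]

theorem integral_add_sq_le {α : Type*} [MeasurableSpace α] {μ : Measure α} {x y : α → ℝ}
    (hx : MemLp x 2 μ) (hy : MemLp y 2 μ) :
    ∫ a, (x a + y a) ^ 2 ∂μ ≤ 2 * ∫ a, x a ^ 2 ∂μ + 2 * ∫ a, y a ^ 2 ∂μ := by
  rw [← integral_const_mul, ← integral_const_mul,
    ← integral_add (hx.integrable_sq.const_mul 2) (hy.integrable_sq.const_mul 2)]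
  refine integral_mono (hx.add hy).integrable_sq
    ((hx.integrable_sq.const_mul 2).add (hy.integrable_sq.const_mul 2)) fun a => ?_
  simp only
  nlinarith [sq_nonneg (x a - y a)]

theorem integral_distortion_sq_le (hT : 0 < T) (hG : AdmissibleKernel G)
    (hg2 : MemLp (fun p : Set.Icc (0 : ℝ) T × Ω => g p.1 p.2) 2 (volume.prod P))
    (hv : Measurable fun p : Set.Icc (0 : ℝ) T × Ω => v p.1 p.2)
    (hv2 : MemLp (fun p : Set.Icc (0 : ℝ) T × Ω => v p.1 p.2) 2 (volume.prod P)) :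
    ∫ p : Set.Icc (0 : ℝ) T × Ω, distortion G g v p.1 p.2 ^ 2 ∂(volume.prod P)
      ≤ 2 * ∫ p : Set.Icc (0 : ℝ) T × Ω, g p.1 p.2 ^ 2 ∂(volume.prod P)
        + 2 * (T * (kernelBound G).toReal *
          ∫ p : Set.Icc (0 : ℝ) T × Ω, v p.1 p.2 ^ 2 ∂(volume.prod P)) :=
  (integral_add_sq_le hg2 (memLp_volterraOp hG hv hv2)).trans (by
    gcongr
    exact integral_volterraOp_sq_le hT hG hv hv2)

theorem integral_mul_le_weighted {α : Type*} [MeasurableSpace α] {μ : Measure α} {x y : α → ℝ}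
    (hx : MemLp x 2 μ) (hy : MemLp y 2 μ) {δ : ℝ} (hδ : 0 < δ) :
    ∫ a, x a * y a ∂μ ≤ 1 / (4 * δ) * ∫ a, x a ^ 2 ∂μ + δ * ∫ a, y a ^ 2 ∂μ := by
  have i1 : Integrable (fun a => x a * y a) μ := hx.integrable_mul hy
  rw [← integral_const_mul, ← integral_const_mul,
    ← integral_add (hx.integrable_sq.const_mul _) (hy.integrable_sq.const_mul δ)]
  refine integral_mono i1
    ((hx.integrable_sq.const_mul _).add (hy.integrable_sq.const_mul δ)) fun a => ?_
  have h1 : 0 ≤ (2 * δ * y a - x a) ^ 2 / (4 * δ) := by positivity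
  have h2 : (2 * δ * y a - x a) ^ 2 / (4 * δ)
      = δ * y a ^ 2 + 1 / (4 * δ) * x a ^ 2 - x a * y a := by
    field_simp
    ring
  simp only
  linarith

/-- Of the available `γ/2`, Young's inequality spends `γ/8` on the signal and `γ/16` on the impact
term; `h(Z)²` consumes another `γ/16` through the bound on `𝐆`. This leaves `γ/4`. The inventory
penalties are nonnegative and are dropped. -/
theorem exists_performance_le [Countable Ω] [DiscreteMeasurableSpace Ω] (hT : 0 < T)
    {γ φ ϱ : ℝ} (X₀ : ℝ) (hγ : 0 < γ) (hφ : 0 ≤ φ) (hϱ : 0 ≤ ϱ) {h : ℝ → ℝ} {L : NNReal}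
    (hL : LipschitzWith L h) (hsub : StrictlySublinear h) (hG : AdmissibleKernel G)
    {S : Set.Icc (0 : ℝ) T → Ω → ℝ} (hS : MemL2 ℱ P S) (hST : MemLp (S (endTime hT)) 2 P)
    (hg : MemL2 ℱ P g) :
    ∃ c : ℝ, ∀ v, MemL2 ℱ P v → performance hT ℱ P γ φ ϱ X₀ h G S g v
      ≤ c - γ / 4 * ∫ p : Set.Icc (0 : ℝ) T × Ω, v p.1 p.2 ^ 2 ∂(volume.prod P) := by
  obtain ⟨a, -, ha2, haeq⟩ := exists_alphaSignal_version hT hS hST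
  set κ := T * (kernelBound G).toReal with hκ
  have hκ0 : 0 ≤ κ := mul_nonneg hT.le ENNReal.toReal_nonneg
  -- Chosen so that `(4/γ) · ε · 2κ ≤ γ/16`, where `4/γ` is the Young constant dual to `γ/16`.
  set ε := γ ^ 2 / (128 * (κ + 1)) with hε
  have hε0 : 0 < ε := by positivity
  obtain ⟨M, -, hM⟩ := hsub.sq_le hε0
  set μ := (volume : Measure (Set.Icc (0 : ℝ) T)).prod P
  set A := ∫ p, a p ^ 2 ∂μ
  set g2 := ∫ p : Set.Icc (0 : ℝ) T × Ω, g p.1 p.2 ^ 2 ∂μ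
  refine ⟨2 / γ * A + 4 / γ * (ε * (2 * g2) + M * μ.real Set.univ)
    + X₀ * ∫ ω, S (endTime hT) ω ∂P, fun v hv => ?_⟩
  obtain ⟨hvm, hv2⟩ := (memL2_iff hT).1 hv
  replace hvm := (measurable_progSigma.1 hvm).1
  rw [performance_eq hT γ φ ϱ X₀ hL hG hS hST hg hv ha2 haeq]
  have hZ := memLp_distortion hG hg.2 hvm hv2
  have hh := memLp_comp_lipschitz hL hZ
  have e1 := integral_mul_le_weighted ha2 hv2 (δ := γ / 8) (by positivity)
  have e2 := integral_mul_le_weighted hh.neg hv2 (δ := γ / 16) (by positivity)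
  simp only [Pi.neg_apply, neg_mul, neg_sq, integral_neg] at e2
  have e3 : ∫ p : Set.Icc (0 : ℝ) T × Ω, h (distortion G g v p.1 p.2) ^ 2 ∂μ
      ≤ ε * ∫ p : Set.Icc (0 : ℝ) T × Ω, distortion G g v p.1 p.2 ^ 2 ∂μ
        + M * μ.real Set.univ := by
    have i1 : Integrable (fun p : Set.Icc (0 : ℝ) T × Ω => ε * distortion G g v p.1 p.2 ^ 2) μ :=
      hZ.integrable_sq.const_mul ε
    have : M * μ.real Set.univ = ∫ _, M ∂μ := by rw [integral_const, smul_eq_mul, mul_comm]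
    rw [this, ← integral_const_mul, ← integral_add i1 (integrable_const M)]
    exact integral_mono hh.integrable_sq (i1.add (integrable_const M)) fun p => hM _
  have e4 := integral_distortion_sq_le hT hG hg.2 hvm hv2
  rw [← hκ] at e4
  have e5 : 0 ≤ φ / 2 * ∫ p : Set.Icc (0 : ℝ) T × Ω, inventory X₀ v p.1 p.2 ^ 2 ∂μ :=
    mul_nonneg (by positivity) (integral_nonneg fun _ => sq_nonneg _)
  have e6 : 0 ≤ ϱ / 2 * ∫ ω, inventory X₀ v (endTime hT) ω ^ 2 ∂P :=
    mul_nonneg (by positivity) (integral_nonneg fun _ => sq_nonneg _)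
  set q := ∫ p : Set.Icc (0 : ℝ) T × Ω, v p.1 p.2 ^ 2 ∂μ
  have hq : 0 ≤ q := integral_nonneg fun _ => sq_nonneg _
  have e7 : 4 / γ * (ε * (2 * (κ * q))) ≤ γ / 16 * q := by
    have : 4 / γ * (ε * (2 * (κ * q))) = γ / 16 * q * (κ / (κ + 1)) := by
      rw [hε]
      field_simp
      ring
    rw [this]
    exact mul_le_of_le_one_right (by positivity) ((div_le_one (by positivity)).2 (by linarith))
  have e8 : 4 / γ * ∫ p : Set.Icc (0 : ℝ) T × Ω, h (distortion G g v p.1 p.2) ^ 2 ∂μ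
      ≤ 4 / γ * (ε * (2 * g2) + M * μ.real Set.univ) + 4 / γ * (ε * (2 * (κ * q))) := by
    rw [← mul_add]
    refine mul_le_mul_of_nonneg_left ?_ (by positivity)
    nlinarith
  have c1 : 1 / (4 * (γ / 8)) = 2 / γ := by
    field_simp
    norm_num
  have c2 : 1 / (4 * (γ / 16)) = 4 / γ := by
    field_simp
    norm_num
  rw [c1] at e1
  rw [c2] at e2
  linarith

theorem exists_globalMaximizer [Countable Ω] [DiscreteMeasurableSpace Ω] (hT : 0 < T)
    {γ φ ϱ : ℝ} (X₀ : ℝ) (hγ : 0 < γ) (hφ : 0 ≤ φ) (hϱ : 0 ≤ ϱ) {h : ℝ → ℝ} {L : NNReal}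
    (hL : LipschitzWith L h) (hsub : StrictlySublinear h) (hG : AdmissibleKernel G)
    {S : Set.Icc (0 : ℝ) T → Ω → ℝ} (hS : MemL2 ℱ P S) (hST : MemLp (S (endTime hT)) 2 P)
    (hg : MemL2 ℱ P g) :
    ∃ v, IsGlobalMaximizer hT ℱ P γ φ ϱ X₀ h G S g v := by
  set J := performance hT ℱ P γ φ ϱ X₀ h G S g with hJ
  set μ := (volume : Measure (Set.Icc (0 : ℝ) T)).prod P
  obtain ⟨c, hc⟩ := exists_performance_le (ℱ := ℱ) hT X₀ hγ hφ hϱ hL hsub hG hS hST hg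
  rw [← hJ] at hc
  have hne : (J '' {v | MemL2 ℱ P v}).Nonempty := ⟨_, _, hS, rfl⟩
  have hbdd : BddAbove (J '' {v | MemL2 ℱ P v}) := by
    refine ⟨c, ?_⟩
    rintro _ ⟨v, hv, rfl⟩
    have := mul_nonneg (by positivity : 0 ≤ γ / 4)
      (integral_nonneg (μ := μ) fun p => sq_nonneg (v p.1 p.2))
    linarith [hc v hv]
  obtain ⟨j, -, hjlim, hj⟩ := exists_seq_tendsto_sSup hne hbdd
  choose u₀ hu₀ hju₀ using hj
  -- A lower bound for `J` along the maximizing sequence, combined with coercivity, bounds the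
  -- sequence in `L²`.
  obtain ⟨b, hb⟩ := hjlim.bddBelow_range
  have hR : ∀ n, ∫ p : Set.Icc (0 : ℝ) T × Ω, u₀ n p.1 p.2 ^ 2 ∂μ ≤ (c - b) * (4 / γ) := by
    intro n
    have h1 := hc (u₀ n) (hu₀ n)
    have h2 : b ≤ J (u₀ n) := hju₀ n ▸ hb ⟨n, rfl⟩
    rw [← div_le_iff₀ (by positivity), div_div_eq_mul_div, mul_comm, mul_div_right_comm,
      mul_comm]
    have : γ / 4 * ∫ p : Set.Icc (0 : ℝ) T × Ω, u₀ n p.1 p.2 ^ 2 ∂μ ≤ c - b := by linarith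
    linarith
  obtain ⟨k, hk, w, hwm, hw2, hweak⟩ := exists_weak_limit (progSigma_le ℱ)
    (f := fun n p => u₀ n p.1 p.2) (fun n => ((memL2_iff hT).1 (hu₀ n)).1)
    (fun n => (hu₀ n).2) hR
  set v : Set.Icc (0 : ℝ) T → Ω → ℝ := fun t ω => w (t, ω)
  have hv : MemL2 ℱ P v := (memL2_iff hT).2 ⟨hwm, hw2⟩
  refine ⟨v, hv, fun v' hv' => (le_csSup hbdd ⟨v', hv', rfl⟩).trans ?_⟩
  set u : ℕ → Set.Icc (0 : ℝ) T → Ω → ℝ := fun n => u₀ (k n)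
  have hu : ∀ n, MemL2 ℱ P (u n) := fun n => hu₀ (k n)
  have hum : ∀ n, Measurable fun p : Set.Icc (0 : ℝ) T × Ω => u n p.1 p.2 := fun n =>
    (measurable_progSigma.1 ((memL2_iff hT).1 (hu n)).1).1
  have hvm : Measurable fun p : Set.Icc (0 : ℝ) T × Ω => v p.1 p.2 := (measurable_progSigma.1 hwm).1
  have hv2 : MemLp (fun p : Set.Icc (0 : ℝ) T × Ω => v p.1 p.2) 2 μ := hw2
  set R := (c - b) * (4 / γ)
  have huR : ∀ n, ∫ p : Set.Icc (0 : ℝ) T × Ω, u n p.1 p.2 ^ 2 ∂μ ≤ R := fun n => hR (k n)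
  have hpoint : ∀ {K : Set.Icc (0 : ℝ) T → Set.Icc (0 : ℝ) T → ℝ}, AdmissibleKernel K →
      ∀ t ω, P {ω} ≠ 0 →
        Tendsto (fun n => volterraOp K (u n) t ω) atTop (𝓝 (volterraOp K v t ω)) := by
    intro K hK t ω hω
    obtain ⟨ψ, hψ, hψK⟩ := integral_representer_mul hK t hω
    have := hweak ψ hψ
    rw [hψK v hv2] at this
    exact this.congr fun n => hψK (u n) (hu n).2
  obtain ⟨a, -, ha2, haeq⟩ := exists_alphaSignal_version hT hS hST
  have hX : ∀ n, MemLp (fun p : Set.Icc (0 : ℝ) T × Ω => inventory X₀ (u n) p.1 p.2) 2 μ :=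
    fun n => memLp_inventory X₀ (hum n) (hu n).2
  have hXv : MemLp (fun p : Set.Icc (0 : ℝ) T × Ω => inventory X₀ v p.1 p.2) 2 μ :=
    memLp_inventory X₀ hvm hv2
  have hXT : ∀ n, MemLp (fun ω => inventory X₀ (u n) (endTime hT) ω) 2 P :=
    fun n => memLp_inventory_apply X₀ (hum n) (hu n).2 _
  have hXTv : MemLp (fun ω => inventory X₀ v (endTime hT) ω) 2 P :=
    memLp_inventory_apply X₀ hvm hv2 _
  have hlimX : ∀ t ω, P {ω} ≠ 0 →
      Tendsto (fun n => inventory X₀ (u n) t ω - inventory X₀ v t ω) atTop (𝓝 0) := by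
    intro t ω hω
    have := (hpoint admissibleKernel_one t ω hω).sub_const (volterraOp (fun _ _ => 1) v t ω)
    rw [sub_self] at this
    simpa only [inventory_eq_add_volterraOp, add_sub_add_left_eq_sub] using this
  have hVdiff : ∀ n t ω, inventory X₀ (u n) t ω - inventory X₀ v t ω
      = volterraOp (fun _ _ => 1) (u n) t ω + -volterraOp (fun _ _ => 1) v t ω := by
    intro n t ω
    rw [inventory_eq_add_volterraOp, inventory_eq_add_volterraOp]
    ring
  have t1 := hweak a ha2
  have t2 := hweak w hw2
  have t3 : Tendsto (fun n => ∫ p : Set.Icc (0 : ℝ) T × Ω,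
      h (distortion G g (u n) p.1 p.2) * u n p.1 p.2 ∂μ) atTop
      (𝓝 (∫ p : Set.Icc (0 : ℝ) T × Ω, h (distortion G g v p.1 p.2) * v p.1 p.2 ∂μ)) := by
    set B := 2 * ∫ p : Set.Icc (0 : ℝ) T × Ω, g p.1 p.2 ^ 2 ∂μ
      + 2 * (T * (kernelBound G).toReal * R)
    refine tendsto_integral_comp_mul (μ := μ) (y := fun n p => u n p.1 p.2)
      (y₀ := fun p => v p.1 p.2) (z := fun n p => distortion G g (u n) p.1 p.2)
      (z₀ := fun p => distortion G g v p.1 p.2) (B := max B R) hL hsub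
      (fun n => memLp_distortion hG hg.2 (hum n) (hu n).2) (memLp_distortion hG hg.2 hvm hv2)
      (fun n => (hu n).2) (fun n => ?_) (fun n => (huR n).trans (le_max_right _ _)) ?_ hweak
    · refine le_trans (integral_distortion_sq_le hT hG hg.2 (hum n) (hu n).2)
        (le_trans ?_ (le_max_left _ _))
      exact add_le_add le_rfl (mul_le_mul_of_nonneg_left (mul_le_mul_of_nonneg_left (huR n)
        (mul_nonneg hT.le ENNReal.toReal_nonneg)) zero_le_two)
    · filter_upwards [ae_prod_singleton_ne_zero P] with p hp
      exact (hpoint hG p.1 p.2 hp).const_add (g p.1 p.2)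
  -- The linear part of the tangent bound at the limit inventory vanishes: the increments tend to
  -- zero pointwise and stay bounded in `L²`.
  have t4 : Tendsto (fun n => ∫ p : Set.Icc (0 : ℝ) T × Ω, inventory X₀ v p.1 p.2
      * (inventory X₀ (u n) p.1 p.2 - inventory X₀ v p.1 p.2) ∂μ) atTop (𝓝 0) := by
    refine tendsto_integral_mul_of_tendsto_ae hXv (fun n => (hX n).sub hXv)
      (B := 2 * (T * (kernelBound (T := T) fun _ _ => 1).toReal * R)
        + 2 * ∫ p : Set.Icc (0 : ℝ) T × Ω, (-volterraOp (fun _ _ => 1) v p.1 p.2) ^ 2 ∂μ)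
      (fun n => ?_) ?_
    · simp only [hVdiff]
      refine (integral_add_sq_le (memLp_volterraOp admissibleKernel_one (hum n) (hu n).2)
        (memLp_volterraOp admissibleKernel_one hvm hv2).neg).trans ?_
      refine add_le_add (mul_le_mul_of_nonneg_left ?_ zero_le_two) le_rfl
      refine (integral_volterraOp_sq_le hT admissibleKernel_one (hum n) (hu n).2).trans ?_
      gcongr
      exact huR n
    · filter_upwards [ae_prod_singleton_ne_zero P] with p hp
      exact hlimX p.1 p.2 hp
  have t5 : Tendsto (fun n => ∫ ω, inventory X₀ v (endTime hT) ω
      * (inventory X₀ (u n) (endTime hT) ω - inventory X₀ v (endTime hT) ω) ∂P) atTop (𝓝 0) := by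
    refine tendsto_integral_mul_of_tendsto_ae hXTv (fun n => (hXT n).sub hXTv)
      (B := 2 * ((kernelBound (T := T) fun _ _ => 1).toReal * R)
        + 2 * ∫ ω, (-volterraOp (fun _ _ => 1) v (endTime hT) ω) ^ 2 ∂P)
      (fun n => ?_) ?_
    · simp only [hVdiff]
      have hV := fun (w : Set.Icc (0 : ℝ) T → Ω → ℝ) hw hw2 =>
        memLp_volterraOp_apply (P := P) (u := w) admissibleKernel_one hw hw2 (endTime hT)
      refine (integral_add_sq_le (hV _ (hum n) (hu n).2).1 (hV _ hvm hv2).1.neg).trans ?_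
      refine add_le_add (mul_le_mul_of_nonneg_left ?_ zero_le_two) le_rfl
      refine (hV _ (hum n) (hu n).2).2.trans ?_
      gcongr
      exact huR n
    · filter_upwards [ae_singleton_ne_zero P] with ω hω
      exact hlimX (endTime hT) ω hω
  -- Each concave quadratic term is replaced by its tangent at the weak limit. Every term on the
  -- right then converges, and the limit is `J v`.
  have hle : ∀ n, J (u n) ≤ ∫ p, a p * u n p.1 p.2 ∂μ
      - γ / 2 * (∫ p, w p ^ 2 ∂μ + 2 * (∫ p, w p * u n p.1 p.2 ∂μ - ∫ p, w p * w p ∂μ))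
      - ∫ p : Set.Icc (0 : ℝ) T × Ω, h (distortion G g (u n) p.1 p.2) * u n p.1 p.2 ∂μ
      - φ / 2 * (∫ p : Set.Icc (0 : ℝ) T × Ω, inventory X₀ v p.1 p.2 ^ 2 ∂μ
        + 2 * ∫ p : Set.Icc (0 : ℝ) T × Ω, inventory X₀ v p.1 p.2
          * (inventory X₀ (u n) p.1 p.2 - inventory X₀ v p.1 p.2) ∂μ)
      - ϱ / 2 * (∫ ω, inventory X₀ v (endTime hT) ω ^ 2 ∂P
        + 2 * ∫ ω, inventory X₀ v (endTime hT) ω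
          * (inventory X₀ (u n) (endTime hT) ω - inventory X₀ v (endTime hT) ω) ∂P)
      + X₀ * ∫ ω, S (endTime hT) ω ∂P := by
    intro n
    rw [hJ, performance_eq hT γ φ ϱ X₀ hL hG hS hST hg (hu n) ha2 haeq]
    have e1 := integral_sq_ge_tangent hw2 (hu n).2
    have i1 : Integrable (fun p : Set.Icc (0 : ℝ) T × Ω => w p * u n p.1 p.2) μ :=
      hw2.integrable_mul (hu n).2
    have i2 : Integrable (fun p : Set.Icc (0 : ℝ) T × Ω => w p * w p) μ := hw2.integrable_mul hw2
    simp only [mul_sub] at e1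
    rw [integral_sub i1 i2] at e1
    gcongr
    · exact integral_sq_ge_tangent hXv (hX n)
    · exact integral_sq_ge_tangent hXTv (hXT n)
  have hlimJ : Tendsto (fun n => J (u n)) atTop (𝓝 (sSup (J '' {v | MemL2 ℱ P v}))) := by
    simp only [u, hju₀]
    exact hjlim.comp hk.tendsto_atTop
  have hrhs := (((((t1.sub ((((t2.sub_const (∫ p, w p * w p ∂μ)).const_mul 2).const_add
    (∫ p, w p ^ 2 ∂μ)).const_mul (γ / 2))).sub t3).sub (((t4.const_mul 2).const_add
    (∫ p : Set.Icc (0 : ℝ) T × Ω, inventory X₀ v p.1 p.2 ^ 2 ∂μ)).const_mul (φ / 2))).sub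
    (((t5.const_mul 2).const_add
    (∫ ω, inventory X₀ v (endTime hT) ω ^ 2 ∂P)).const_mul (ϱ / 2))).add_const
    (X₀ * ∫ ω, S (endTime hT) ω ∂P))
  refine (le_of_tendsto_of_tendsto' hlimJ hrhs hle).trans (le_of_eq ?_)
  rw [performance_eq hT γ φ ϱ X₀ hL hG hS hST hg hv ha2 haeq]
  simp only [μ, v, sub_self, mul_zero, add_zero]

end

section

variable {T : ℝ} {Ω : Type*} [mΩ : MeasurableSpace Ω] {P : Measure Ω} [IsProbabilityMeasure P]
  {ℱ : Filtration (Set.Icc (0 : ℝ) T) mΩ} {K : Set.Icc (0 : ℝ) T → Set.Icc (0 : ℝ) T → ℝ}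
  {w : Set.Icc (0 : ℝ) T → Ω → ℝ}

/-! ### The adjoint Volterra operator -/

theorem lintegral_enorm_condExp_le {α : Type*} {m m0 : MeasurableSpace α} {μ : Measure α}
    (X : α → ℝ) : ∫⁻ a, ‖(μ[X | m]) a‖ₑ ∂μ ≤ ∫⁻ a, ‖X a‖ₑ ∂μ := by
  simpa only [eLpNorm_one_eq_lintegral_enorm] using
    eLpNorm_condExp_le_eLpNorm (m := m) (μ := μ) X (p := 1) le_rfl

/-- The integrand of the adjoint Volterra operator, as a function on `[0,T] × ([0,T] × Ω)`. -/
noncomputable def adjIntegrand (K : Set.Icc (0 : ℝ) T → Set.Icc (0 : ℝ) T → ℝ)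
    (c : Set.Icc (0 : ℝ) T × (Set.Icc (0 : ℝ) T × Ω) → ℝ)
    (q : Set.Icc (0 : ℝ) T × (Set.Icc (0 : ℝ) T × Ω)) : ℝ :=
  (Set.Iic q.1).indicator (K q.1) q.2.1 * c q

theorem measurable_adjIntegrand (hK : AdmissibleKernel K)
    {c : Set.Icc (0 : ℝ) T × (Set.Icc (0 : ℝ) T × Ω) → ℝ} (hc : Measurable c) :
    Measurable (adjIntegrand K c) := by
  refine Measurable.mul ?_ hc
  have : (fun q : Set.Icc (0 : ℝ) T × (Set.Icc (0 : ℝ) T × Ω) =>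
      (Set.Iic q.1).indicator (K q.1) q.2.1)
      = {q | q.2.1 ≤ q.1}.indicator fun q => K q.1 q.2.1 := by
    ext q
    simp [Set.indicator]
  rw [this]
  exact (hK.measurable.comp (measurable_fst.prodMk measurable_snd.fst)).indicator
    (measurableSet_le measurable_snd.fst measurable_fst)

/-- Cauchy–Schwarz bounds the `L¹` norm of `K(t,·)` on `[0,t]` uniformly in `t`. The hypothesis on
`c` is met both by `w` itself and by its conditional averages, the two integrands compared in the
duality formula. -/
theorem integrable_adjIntegrand (hK : AdmissibleKernel K)
    (hw : Measurable fun p : Set.Icc (0 : ℝ) T × Ω => w p.1 p.2)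
    (hw1 : Integrable (fun p : Set.Icc (0 : ℝ) T × Ω => w p.1 p.2) (volume.prod P))
    {c : Set.Icc (0 : ℝ) T × (Set.Icc (0 : ℝ) T × Ω) → ℝ} (hc : Measurable c)
    (hcw : ∀ᵐ t, ∀ s, ∫⁻ ω, ‖c (t, (s, ω))‖ₑ ∂P ≤ ∫⁻ ω, ‖w t ω‖ₑ ∂P) :
    Integrable (adjIntegrand K c) (volume.prod (volume.prod P)) := by
  have hm := measurable_adjIntegrand hK hc
  refine ⟨hm.aestronglyMeasurable, ?_⟩
  rw [hasFiniteIntegral_iff_enorm, lintegral_prod _ hm.enorm.aemeasurable]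
  set B := (kernelBound K * volume (Set.univ : Set (Set.Icc (0 : ℝ) T))) ^ (1 / 2 : ℝ) with hB
  have hBtop : B < ∞ :=
    ENNReal.rpow_lt_top_of_nonneg (by norm_num)
      (ENNReal.mul_lt_top hK.bounded (measure_lt_top _ _)).ne
  have hKB : ∀ t, ∫⁻ s, ‖(Set.Iic t).indicator (K t) s‖ₑ ≤ B := by
    intro t
    have h1 := hK.lintegral_enorm_mul_sq_le (f := fun _ => 1) measurable_const t
    simp only [mul_one, enorm_one, one_pow, lintegral_const, one_mul] at h1
    have h2 : ∫⁻ s, ‖(Set.Iic t).indicator (K t) s‖ₑ = ∫⁻ s in Set.Iic t, ‖K t s‖ₑ := by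
      rw [← lintegral_indicator measurableSet_Iic]
      refine lintegral_congr fun s => ?_
      rw [enorm_indicator_eq_indicator_enorm]
    rw [h2, hB, one_div]
    rw [← ENNReal.rpow_natCast] at h1
    exact (ENNReal.le_rpow_inv_iff (by norm_num)).2 (by exact_mod_cast h1)
  have hw1' := hw1.2
  rw [hasFiniteIntegral_iff_enorm, lintegral_prod _ hw.enorm.aemeasurable] at hw1'
  refine lt_of_le_of_lt (lintegral_mono_ae (g := fun t => B * ∫⁻ ω, ‖w t ω‖ₑ ∂P) ?_) ?_
  · filter_upwards [hcw] with t ht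
    have hmt : Measurable fun p : Set.Icc (0 : ℝ) T × Ω => ‖adjIntegrand K c (t, p)‖ₑ :=
      (hm.comp measurable_prodMk_left).enorm
    rw [lintegral_prod _ hmt.aemeasurable]
    calc ∫⁻ s, ∫⁻ ω, ‖adjIntegrand K c (t, (s, ω))‖ₑ ∂P
        = ∫⁻ s, ‖(Set.Iic t).indicator (K t) s‖ₑ * ∫⁻ ω, ‖c (t, (s, ω))‖ₑ ∂P := by
          refine lintegral_congr fun s => ?_
          simp only [adjIntegrand, enorm_mul]
          refine lintegral_const_mul _ (hc.comp ?_).enorm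
          exact measurable_prodMk_left.comp measurable_prodMk_left
      _ ≤ ∫⁻ s, ‖(Set.Iic t).indicator (K t) s‖ₑ * ∫⁻ ω, ‖w t ω‖ₑ ∂P :=
          lintegral_mono fun s => mul_le_mul' le_rfl (ht s)
      _ = (∫⁻ s, ‖(Set.Iic t).indicator (K t) s‖ₑ) * ∫⁻ ω, ‖w t ω‖ₑ ∂P :=
          lintegral_mul_const _ ((hK.measurable_left t).indicator measurableSet_Iic).enorm
      _ ≤ _ := mul_le_mul' (hKB t) le_rfl
  · rw [lintegral_const_mul _ (hw.enorm.lintegral_prod_right')]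
    exact ENNReal.mul_lt_top hBtop hw1'

/-- A progressively measurable version of `𝐊*w`. -/
noncomputable def adjVersion (ℱ : Filtration (Set.Icc (0 : ℝ) T) mΩ) (P : Measure Ω)
    (K : Set.Icc (0 : ℝ) T → Set.Icc (0 : ℝ) T → ℝ) (w : Set.Icc (0 : ℝ) T → Ω → ℝ)
    (p : Set.Icc (0 : ℝ) T × Ω) : ℝ :=
  ∫ t, adjIntegrand K (fun q => atomAverage (ℱ q.2.1) P (w q.1) q.2.2) (t, p)

theorem measurable_indicator_one {A : Set (Set.Icc (0 : ℝ) T × Ω)} (hA : MeasurableSet A) :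
    Measurable fun p : Set.Icc (0 : ℝ) T × Ω => A.indicator (1 : Set.Icc (0 : ℝ) T × Ω → ℝ) (p.1, p.2) :=
  measurable_one.indicator hA

theorem memLp_indicator_one {A : Set (Set.Icc (0 : ℝ) T × Ω)} (hA : MeasurableSet A) :
    MemLp (fun p : Set.Icc (0 : ℝ) T × Ω => A.indicator (1 : Set.Icc (0 : ℝ) T × Ω → ℝ) (p.1, p.2)) 2
      (volume.prod P) :=
  (memLp_const (1 : ℝ)).indicator hA

variable [Countable Ω] [DiscreteMeasurableSpace Ω]

theorem measurable_atomAverage_triple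
    (hw : Measurable fun p : Set.Icc (0 : ℝ) T × Ω => w p.1 p.2) :
    Measurable fun q : Set.Icc (0 : ℝ) T × (Set.Icc (0 : ℝ) T × Ω) =>
      atomAverage (ℱ q.2.1) P (w q.1) q.2.2 := by
  have h : Measurable fun q : Set.Icc (0 : ℝ) T × (Set.Icc (0 : ℝ) T × Ω) =>
    ((q.2.1, q.1), q.2.2) := by fun_prop
  have h' := Measurable.comp (measurable_atomAverage (P := P) ℱ hw) h
  simpa only [Function.comp_def] using h'

theorem integrable_adjIntegrand_atomAverage (hK : AdmissibleKernel K)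
    (hw : Measurable fun p : Set.Icc (0 : ℝ) T × Ω => w p.1 p.2)
    (hw1 : Integrable (fun p : Set.Icc (0 : ℝ) T × Ω => w p.1 p.2) (volume.prod P)) :
    Integrable (adjIntegrand K fun q : Set.Icc (0 : ℝ) T × (Set.Icc (0 : ℝ) T × Ω) =>
      atomAverage (ℱ q.2.1) P (w q.1) q.2.2) (volume.prod (volume.prod P)) := by
  refine integrable_adjIntegrand hK hw hw1 (measurable_atomAverage_triple hw) ?_
  filter_upwards [hw1.prod_right_ae] with t ht s
  refine le_trans (le_of_eq (lintegral_congr_ae ?_)) (lintegral_enorm_condExp_le (m := ℱ s) (w t))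
  filter_upwards [ae_singleton_ne_zero P] with ω hω
  rw [condExp_eq_atomAverage (ℱ.le s) ht hω]

theorem progMeasurable_adjVersion (hK : AdmissibleKernel K)
    (hw : Measurable fun p : Set.Icc (0 : ℝ) T × Ω => w p.1 p.2) :
    Measurable[progSigma ℱ] (adjVersion ℱ P K w) := by
  refine measurable_progSigma.2 ⟨?_, fun s => ?_⟩
  · exact (StronglyMeasurable.integral_prod_left' (measurable_adjIntegrand hK
      (measurable_atomAverage_triple hw)).stronglyMeasurable).measurable
  · refine measurable_of_forall_measurableAtom fun ω ω' h => ?_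
    have : ∀ t, atomAverage (ℱ s) P (w t) ω' = atomAverage (ℱ s) P (w t) ω :=
      fun t => atomAverage_eq_of_mem h
    simp only [adjVersion, adjIntegrand, this]

theorem integrable_adjVersion (hK : AdmissibleKernel K)
    (hw : Measurable fun p : Set.Icc (0 : ℝ) T × Ω => w p.1 p.2)
    (hw1 : Integrable (fun p : Set.Icc (0 : ℝ) T × Ω => w p.1 p.2) (volume.prod P)) :
    Integrable (adjVersion ℱ P K w) (volume.prod P) :=
  (integrable_adjIntegrand_atomAverage hK hw hw1).integral_prod_right

/-- At a point with `P {ω} > 0` the two integrands agree for every `t` at which `w t` is integrable,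
hence for almost every `t`. Absolute convergence is the Fubini section of an integrable function on
the triple product. -/
theorem volterraAdj_ae_eq (hK : AdmissibleKernel K)
    (hw : Measurable fun p : Set.Icc (0 : ℝ) T × Ω => w p.1 p.2)
    (hw1 : Integrable (fun p : Set.Icc (0 : ℝ) T × Ω => w p.1 p.2) (volume.prod P)) :
    ∀ᵐ p : Set.Icc (0 : ℝ) T × Ω ∂(volume.prod P),
      IntegrableOn (fun t => K t p.1 * (P[w t | ℱ p.1]) p.2) (Set.Ici p.1) ∧
        volterraAdj ℱ P K w p.1 p.2 = adjVersion ℱ P K w p := by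
  have hae : ∀ᵐ t, Integrable (w t) P := hw1.prod_right_ae
  filter_upwards [(integrable_adjIntegrand_atomAverage (ℱ := ℱ) hK hw hw1).prod_left_ae,
    ae_prod_singleton_ne_zero P] with p hp hω
  have heq : (fun t => adjIntegrand K (fun q => atomAverage (ℱ q.2.1) P (w q.1) q.2.2) (t, p))
      =ᵐ[volume] (Set.Ici p.1).indicator fun t => K t p.1 * (P[w t | ℱ p.1]) p.2 := by
    filter_upwards [hae] with t ht
    rw [adjIntegrand]
    simp only [Set.indicator, Set.mem_Iic, Set.mem_Ici]
    split_ifs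
    · rw [condExp_eq_atomAverage (ℱ.le p.1) ht hω]
    · rw [zero_mul]
  refine ⟨(integrable_indicator_iff measurableSet_Ici).1 (hp.congr heq), ?_⟩
  rw [volterraAdj, adjVersion, integral_congr_ae heq, integral_indicator measurableSet_Ici]

/-- The duality `⟨1_A, 𝐊*w⟩ = ⟨𝐊 1_A, w⟩`. After Fubini on `[0,T]² × Ω`, for fixed `(t, s)` the
section of `A` at `s` belongs to `ℱ s`, so conditioning `w t` on `ℱ s` does not change its integral
there. -/
theorem setIntegral_adjVersion (hK : AdmissibleKernel K)
    (hw : Measurable fun p : Set.Icc (0 : ℝ) T × Ω => w p.1 p.2)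
    (hw2 : MemLp (fun p : Set.Icc (0 : ℝ) T × Ω => w p.1 p.2) 2 (volume.prod P))
    {A : Set (Set.Icc (0 : ℝ) T × Ω)} (hA : MeasurableSet[progSigma ℱ] A) :
    ∫ p in A, adjVersion ℱ P K w p ∂(volume.prod P)
      = ∫ p : Set.Icc (0 : ℝ) T × Ω,
        volterraOp K (fun t ω => A.indicator 1 (t, ω)) p.1 p.2 * w p.1 p.2 ∂(volume.prod P) := by
  obtain ⟨hAm, hAs⟩ := measurableSet_progSigma.1 hA
  have hw1 := hw2.integrable (by norm_num)
  have hA2 : MeasurableSet (Prod.snd ⁻¹' A : Set (Set.Icc (0 : ℝ) T × (Set.Icc (0 : ℝ) T × Ω))) :=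
    hAm.preimage measurable_snd
  have hwm : Measurable fun q : Set.Icc (0 : ℝ) T × (Set.Icc (0 : ℝ) T × Ω) => w q.1 q.2.2 :=
    hw.comp (measurable_fst.prodMk measurable_snd.snd)
  have i1 := (integrable_adjIntegrand_atomAverage (ℱ := ℱ) hK hw hw1).indicator hA2
  have i2 := (integrable_adjIntegrand hK hw hw1 hwm
    (ae_of_all _ fun t s => le_rfl)).indicator hA2
  have e1 : ∫ p in A, adjVersion ℱ P K w p ∂(volume.prod P)
      = ∫ q, (Prod.snd ⁻¹' A).indicator (adjIntegrand K fun q => atomAverage (ℱ q.2.1) P (w q.1) q.2.2) q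
        ∂((volume : Measure (Set.Icc (0 : ℝ) T)).prod (volume.prod P)) := by
    rw [integral_prod_symm _ i1, ← integral_indicator hAm]
    refine integral_congr_ae (ae_of_all _ fun p => ?_)
    by_cases hp : p ∈ A
    · simp only [Set.indicator, Set.mem_preimage, hp, if_true]
      rfl
    · simp [Set.indicator, hp]
  have e2 : ∫ p : Set.Icc (0 : ℝ) T × Ω,
        volterraOp K (fun t ω => A.indicator 1 (t, ω)) p.1 p.2 * w p.1 p.2 ∂(volume.prod P)
      = ∫ q, (Prod.snd ⁻¹' A).indicator (adjIntegrand K fun q => w q.1 q.2.2) q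
        ∂((volume : Measure (Set.Icc (0 : ℝ) T)).prod (volume.prod P)) := by
    have i3 : Integrable (fun p : Set.Icc (0 : ℝ) T × Ω =>
        volterraOp K (fun t ω => A.indicator 1 (t, ω)) p.1 p.2 * w p.1 p.2) (volume.prod P) :=
      (memLp_volterraOp hK (measurable_indicator_one hAm)
        (memLp_indicator_one hAm)).integrable_mul hw2
    rw [integral_prod _ i2, integral_prod _ i3]
    refine integral_congr_ae ?_
    filter_upwards [i2.prod_right_ae] with t ht
    rw [integral_prod_symm _ ht]
    refine integral_congr_ae (ae_of_all _ fun ω => ?_)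
    simp only [volterraOp]
    rw [← integral_mul_const, ← integral_indicator measurableSet_Iic]
    refine integral_congr_ae (ae_of_all _ fun s => ?_)
    by_cases h1 : (s, ω) ∈ A <;> by_cases h2 : s ≤ t <;> simp [Set.indicator, adjIntegrand, h1, h2]
  rw [e1, e2, integral_prod _ i1, integral_prod _ i2]
  refine integral_congr_ae ?_
  filter_upwards [i1.prod_right_ae, i2.prod_right_ae, hw1.prod_right_ae] with t h1 h2 ht
  rw [integral_prod _ h1, integral_prod _ h2]
  refine integral_congr_ae (ae_of_all _ fun s => ?_)
  have hs : MeasurableSet[ℱ s] {ω | (s, ω) ∈ A} := hAs s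
  have hind : ∀ c : Set.Icc (0 : ℝ) T × (Set.Icc (0 : ℝ) T × Ω) → ℝ,
      ∫ ω, (Prod.snd ⁻¹' A).indicator (adjIntegrand K c) (t, (s, ω)) ∂P
        = (Set.Iic t).indicator (K t) s * ∫ ω in {ω | (s, ω) ∈ A}, c (t, (s, ω)) ∂P := by
    intro c
    rw [← integral_const_mul, ← integral_indicator (ℱ.le s _ hs)]
    rfl
  simp only [hind]
  congr 1
  rw [← setIntegral_condExp (ℱ.le s) ht hs]
  refine setIntegral_congr_ae (ℱ.le s _ hs) ?_
  filter_upwards [ae_singleton_ne_zero P] with ω hω _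
  rw [condExp_eq_atomAverage (ℱ.le s) ht hω]

end

section

variable {T : ℝ}

/-! ### The quadratic inventory penalty -/

theorem integral_integral_Iic {y : Set.Icc (0 : ℝ) T → ℝ} (hy : Integrable y) :
    ∫ t, ∫ s in Set.Iic t, y s = ∫ s, y s * (T - s) := by
  have hm : MeasurableSet {q : Set.Icc (0 : ℝ) T × Set.Icc (0 : ℝ) T | q.2 ≤ q.1} :=
    measurableSet_le measurable_snd measurable_fst
  have hi : Integrable ({q : Set.Icc (0 : ℝ) T × Set.Icc (0 : ℝ) T | q.2 ≤ q.1}.indicator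
      fun q => y q.2) (volume.prod volume) := (hy.comp_snd volume).indicator hm
  have h1 : ∫ t, ∫ s in Set.Iic t, y s = ∫ q, {q : Set.Icc (0 : ℝ) T × Set.Icc (0 : ℝ) T |
      q.2 ≤ q.1}.indicator (fun q => y q.2) q ∂(volume.prod volume) := by
    rw [integral_prod _ hi]
    refine integral_congr_ae (ae_of_all _ fun t => ?_)
    simp only
    rw [← integral_indicator measurableSet_Iic]
    rfl
  rw [h1, integral_prod_symm _ hi]
  refine integral_congr_ae (ae_of_all _ fun s => ?_)
  have : ∀ t, {q : Set.Icc (0 : ℝ) T × Set.Icc (0 : ℝ) T | q.2 ≤ q.1}.indicator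
      (fun q => y q.2) (t, s) = (Set.Ici s).indicator (fun _ => y s) t := fun t => by
    simp [Set.indicator]
  simp only [this]
  rw [integral_indicator measurableSet_Ici, setIntegral_const, volumeReal_Ici, smul_eq_mul,
    mul_comm]

theorem setIntegral_kernelH_mul (φ ϱ : ℝ) (x : Set.Icc (0 : ℝ) T → ℝ) (t : Set.Icc (0 : ℝ) T) :
    ∫ s in Set.Iic t, kernelH φ ϱ t s * x s = ∫ s, kernelH φ ϱ t s * x s := by
  refine setIntegral_eq_integral_of_forall_compl_eq_zero fun s hs => ?_
  have : ¬ s < t := fun h => hs h.le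
  simp [kernelH, this]

theorem kernelH_add_kernelH_swap (φ ϱ : ℝ) {r s : Set.Icc (0 : ℝ) T} (h : r ≠ s) :
    kernelH φ ϱ r s + kernelH φ ϱ s r = φ * (T - (max r s : Set.Icc (0 : ℝ) T)) + ϱ := by
  rcases lt_or_gt_of_ne h with h | h
  · simp [kernelH, h, h.le, not_lt_of_gt h]
  · simp [kernelH, h, h.le, not_lt_of_gt h]

/-- Both sides integrate `x(r) y(s)` against `φ (T - max r s) + ϱ`: on the left because `r` and `s`
both lie below `t` exactly for `t ≥ max r s`, on the right because `H(r,s) + H(s,r)` is this kernel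
off the diagonal. On the diagonal `H` vanishes, but the diagonal is a null set. -/
theorem integral_penalty_eq {φ ϱ : ℝ} (hφ : 0 ≤ φ) (hϱ : 0 ≤ ϱ) {x y : Set.Icc (0 : ℝ) T → ℝ}
    (hx : Integrable x) (hy : Integrable y) :
    φ * (∫ t, (∫ r in Set.Iic t, x r) * ∫ s in Set.Iic t, y s) + ϱ * ((∫ r, x r) * ∫ s, y s)
      = (∫ s, y s * ∫ r in Set.Iic s, kernelH φ ϱ s r * x r)
        + ∫ r, x r * ∫ s in Set.Iic r, kernelH φ ϱ r s * y s := by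
  set ν := (volume : Measure (Set.Icc (0 : ℝ) T)).prod (volume : Measure (Set.Icc (0 : ℝ) T))
    with hν
  have hxy : Integrable (fun z : Set.Icc (0 : ℝ) T × Set.Icc (0 : ℝ) T => x z.1 * y z.2) ν :=
    hx.mul_prod hy
  have hHm : Measurable fun z : Set.Icc (0 : ℝ) T × Set.Icc (0 : ℝ) T => kernelH φ ϱ z.1 z.2 :=
    (admissibleKernel_kernelH hφ hϱ).measurable
  have i1 : Integrable (fun z : Set.Icc (0 : ℝ) T × Set.Icc (0 : ℝ) T =>
      kernelH φ ϱ z.2 z.1 * (x z.1 * y z.2)) ν :=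
    hxy.bdd_mul (c := φ * T + ϱ) (hHm.comp measurable_swap).aestronglyMeasurable
      (ae_of_all _ fun z => abs_kernelH_le hφ hϱ _ _)
  have i2 : Integrable (fun z : Set.Icc (0 : ℝ) T × Set.Icc (0 : ℝ) T =>
      kernelH φ ϱ z.1 z.2 * (x z.1 * y z.2)) ν :=
    hxy.bdd_mul (c := φ * T + ϱ) hHm.aestronglyMeasurable
      (ae_of_all _ fun z => abs_kernelH_le hφ hϱ _ _)
  have e1 : (∫ s, y s * ∫ r in Set.Iic s, kernelH φ ϱ s r * x r)
      = ∫ z, kernelH φ ϱ z.2 z.1 * (x z.1 * y z.2) ∂ν := by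
    rw [hν, integral_prod_symm _ i1]
    refine integral_congr_ae (ae_of_all _ fun s => ?_)
    simp only
    rw [setIntegral_kernelH_mul, ← integral_const_mul]
    exact integral_congr_ae (ae_of_all _ fun r => by ring)
  have e2 : (∫ r, x r * ∫ s in Set.Iic r, kernelH φ ϱ r s * y s)
      = ∫ z, kernelH φ ϱ z.1 z.2 * (x z.1 * y z.2) ∂ν := by
    rw [hν, integral_prod _ i2]
    refine integral_congr_ae (ae_of_all _ fun r => ?_)
    simp only
    rw [setIntegral_kernelH_mul, ← integral_const_mul]
    exact integral_congr_ae (ae_of_all _ fun s => by ring)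
  have hdiag : ∀ᵐ z : Set.Icc (0 : ℝ) T × Set.Icc (0 : ℝ) T ∂ν, z.1 ≠ z.2 := by
    have hm : MeasurableSet {z : Set.Icc (0 : ℝ) T × Set.Icc (0 : ℝ) T | z.1 ≠ z.2} :=
      (measurableSet_eq_fun measurable_fst measurable_snd).compl
    refine (Measure.ae_prod_iff_ae_ae hm).2 (ae_of_all _ fun r => ?_)
    filter_upwards [compl_mem_ae_iff.2 (measure_singleton r)] with s hs
    exact fun h => hs h.symm
  have e3 : ∫ t, (∫ r in Set.Iic t, x r) * ∫ s in Set.Iic t, y s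
      = ∫ z, (x z.1 * y z.2) * (T - (max z.1 z.2 : Set.Icc (0 : ℝ) T)) ∂ν := by
    have hm : MeasurableSet {q : Set.Icc (0 : ℝ) T × (Set.Icc (0 : ℝ) T × Set.Icc (0 : ℝ) T) |
        max q.2.1 q.2.2 ≤ q.1} :=
      measurableSet_le (measurable_snd.fst.max measurable_snd.snd) measurable_fst
    have hi : Integrable ({q : Set.Icc (0 : ℝ) T × (Set.Icc (0 : ℝ) T × Set.Icc (0 : ℝ) T) |
        max q.2.1 q.2.2 ≤ q.1}.indicator fun q => x q.2.1 * y q.2.2)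
        ((volume : Measure (Set.Icc (0 : ℝ) T)).prod ν) :=
      (hxy.comp_snd volume).indicator hm
    have h1 : ∫ t, (∫ r in Set.Iic t, x r) * ∫ s in Set.Iic t, y s
        = ∫ q, {q : Set.Icc (0 : ℝ) T × (Set.Icc (0 : ℝ) T × Set.Icc (0 : ℝ) T) |
        max q.2.1 q.2.2 ≤ q.1}.indicator (fun q => x q.2.1 * y q.2.2) q ∂(volume.prod ν) := by
      rw [integral_prod _ hi]
      refine integral_congr_ae (ae_of_all _ fun t => ?_)
      simp only
      rw [← integral_indicator measurableSet_Iic, ← integral_indicator measurableSet_Iic,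
        ← integral_prod_mul]
      refine integral_congr_ae (ae_of_all _ fun z => ?_)
      by_cases h1 : z.1 ≤ t <;> by_cases h2 : z.2 ≤ t <;> simp [Set.indicator, h1, h2]
    rw [h1, integral_prod_symm _ hi]
    refine integral_congr_ae (ae_of_all _ fun z => ?_)
    have : ∀ t, {q : Set.Icc (0 : ℝ) T × (Set.Icc (0 : ℝ) T × Set.Icc (0 : ℝ) T) |
        max q.2.1 q.2.2 ≤ q.1}.indicator (fun q => x q.2.1 * y q.2.2) (t, z)
        = (Set.Ici (max z.1 z.2)).indicator (fun _ => x z.1 * y z.2) t := fun t => by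
      simp [Set.indicator]
    simp only [this]
    rw [integral_indicator measurableSet_Ici, setIntegral_const, volumeReal_Ici, smul_eq_mul,
      mul_comm]
  have i3 : Integrable (fun z : Set.Icc (0 : ℝ) T × Set.Icc (0 : ℝ) T =>
      (x z.1 * y z.2) * (T - (max z.1 z.2 : Set.Icc (0 : ℝ) T))) ν := by
    refine hxy.mul_bdd (c := T) ?_ (ae_of_all _ fun z => ?_)
    · exact (measurable_const.sub (measurable_subtype_coe.comp
        (measurable_fst.max measurable_snd))).aestronglyMeasurable
    · have h1 := (max z.1 z.2).2.1
      have h2 := (max z.1 z.2).2.2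
      rw [Real.norm_eq_abs, abs_of_nonneg (by linarith)]
      linarith
  rw [e1, e2, e3, ← integral_prod_mul (μ := volume) (ν := volume) x y, ← hν, ← integral_const_mul,
    ← integral_const_mul, ← integral_add (i3.const_mul φ) (hxy.const_mul ϱ), ← integral_add i1 i2]
  refine integral_congr_ae ?_
  filter_upwards [hdiag] with z hz
  have := kernelH_add_kernelH_swap φ ϱ hz
  linear_combination (-(x z.1 * y z.2)) * this

end

section

variable {T : ℝ} {Ω : Type*} [mΩ : MeasurableSpace Ω]
  {ℱ : Filtration (Set.Icc (0 : ℝ) T) mΩ} {G : Set.Icc (0 : ℝ) T → Set.Icc (0 : ℝ) T → ℝ}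
  {g u v : Set.Icc (0 : ℝ) T → Ω → ℝ}

theorem memL2_add_mul [Countable Ω] {P : Measure Ω} (hT : 0 < T) (hu : MemL2 ℱ P u) (hv : MemL2 ℱ P v) (ε : ℝ) :
    MemL2 ℱ P fun t ω => u t ω + ε * v t ω := by
  obtain ⟨hum, hu2⟩ := (memL2_iff hT).1 hu
  obtain ⟨hvm, hv2⟩ := (memL2_iff hT).1 hv
  rw [measurable_progSigma] at hum hvm
  exact (memL2_iff hT).2 ⟨measurable_progSigma.2 ⟨hum.1.add (hvm.1.const_mul ε),
    fun t => (hum.2 t).add ((hvm.2 t).const_mul ε)⟩, hu2.add (hv2.const_mul ε)⟩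

variable {P : Measure Ω} [IsProbabilityMeasure P]

theorem memLp_initialPenalty {φ ϱ : ℝ} (hφ : 0 ≤ φ) (hϱ : 0 ≤ ϱ) (X₀ : ℝ) :
    MemLp (fun p : Set.Icc (0 : ℝ) T × Ω => X₀ * (φ * (T - p.1) + ϱ)) 2 (volume.prod P) := by
  refine MemLp.of_bound (C := |X₀| * (φ * T + ϱ)) (Measurable.aestronglyMeasurable ?_)
    (ae_of_all _ fun p => ?_)
  · fun_prop
  · have ht := p.1.2.1
    have ht' := p.1.2.2
    have h3 : 0 ≤ φ * (T - p.1) := mul_nonneg hφ (by linarith)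
    have h4 : 0 ≤ φ * p.1 := mul_nonneg hφ ht
    rw [norm_mul, Real.norm_eq_abs, Real.norm_eq_abs,
      abs_of_nonneg (by linarith : 0 ≤ φ * (T - p.1) + ϱ)]
    exact mul_le_mul_of_nonneg_left (by linarith) (abs_nonneg _)

/-- This is the directional derivative of the inventory penalty, computed path by path. The constant
`X₀` contributes the source term `X₀ (φ (T - t) + ϱ)`; the remaining bilinear form is
`integral_penalty_eq`. -/
theorem integral_inventory_mul_eq [Countable Ω] (hT : 0 < T) {φ ϱ : ℝ} (hφ : 0 ≤ φ) (hϱ : 0 ≤ ϱ)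
    (X₀ : ℝ) (hu : Measurable fun p : Set.Icc (0 : ℝ) T × Ω => u p.1 p.2)
    (hu2 : MemLp (fun p : Set.Icc (0 : ℝ) T × Ω => u p.1 p.2) 2 (volume.prod P))
    (hv : Measurable fun p : Set.Icc (0 : ℝ) T × Ω => v p.1 p.2)
    (hv2 : MemLp (fun p : Set.Icc (0 : ℝ) T × Ω => v p.1 p.2) 2 (volume.prod P)) :
    φ * ∫ p : Set.Icc (0 : ℝ) T × Ω, inventory X₀ u p.1 p.2
        * volterraOp (fun _ _ => 1) v p.1 p.2 ∂(volume.prod P)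
      + ϱ * ∫ ω, inventory X₀ u (endTime hT) ω * volterraOp (fun _ _ => 1) v (endTime hT) ω ∂P
      = ∫ p : Set.Icc (0 : ℝ) T × Ω, v p.1 p.2
          * (X₀ * (φ * (T - p.1) + ϱ) + volterraOp (kernelH φ ϱ) u p.1 p.2) ∂(volume.prod P)
        + ∫ p : Set.Icc (0 : ℝ) T × Ω, volterraOp (kernelH φ ϱ) v p.1 p.2 * u p.1 p.2
          ∂(volume.prod P) := by
  have hH := admissibleKernel_kernelH (T := T) hφ hϱ
  have h1 := admissibleKernel_one (T := T)
  have hc := memLp_initialPenalty (T := T) (P := P) hφ hϱ X₀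
  have i1 : Integrable (fun p : Set.Icc (0 : ℝ) T × Ω => inventory X₀ u p.1 p.2
      * volterraOp (fun _ _ => 1) v p.1 p.2) (volume.prod P) :=
    (memLp_inventory X₀ hu hu2).integrable_mul (memLp_volterraOp h1 hv hv2)
  have i2 : Integrable (fun ω => inventory X₀ u (endTime hT) ω
      * volterraOp (fun _ _ => 1) v (endTime hT) ω) P :=
    (memLp_inventory_apply X₀ hu hu2 _).integrable_mul (memLp_volterraOp_apply h1 hv hv2 _).1
  have i3 : Integrable (fun p : Set.Icc (0 : ℝ) T × Ω => v p.1 p.2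
      * (X₀ * (φ * (T - p.1) + ϱ) + volterraOp (kernelH φ ϱ) u p.1 p.2)) (volume.prod P) :=
    hv2.integrable_mul (hc.add (memLp_volterraOp hH hu hu2))
  have i4 : Integrable (fun p : Set.Icc (0 : ℝ) T × Ω =>
      volterraOp (kernelH φ ϱ) v p.1 p.2 * u p.1 p.2) (volume.prod P) :=
    (memLp_volterraOp hH hv hv2).integrable_mul hu2
  rw [integral_prod_symm _ i1, integral_prod_symm _ i3, integral_prod_symm _ i4,
    ← integral_const_mul, ← integral_const_mul,
    ← integral_add (i1.integral_prod_right.const_mul φ) (i2.const_mul ϱ),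
    ← integral_add i3.integral_prod_right i4.integral_prod_right]
  refine integral_congr_ae ?_
  filter_upwards [ae_singleton_ne_zero P] with ω hω
  have hx := memLp_section hu hu2 hω
  have hy := memLp_section hv hv2 hω
  have hU := memLp_section (measurable_volterraOp h1 hu) (memLp_volterraOp h1 hu hu2) hω
  have hV := memLp_section (measurable_volterraOp h1 hv) (memLp_volterraOp h1 hv hv2) hω
  have hHu := memLp_section (measurable_volterraOp hH hu) (memLp_volterraOp hH hu hu2) hω
  have j1 : Integrable fun t => volterraOp (fun _ _ => 1) u t ω * volterraOp (fun _ _ => 1) v t ω :=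
    hU.integrable_mul hV
  have j2 : Integrable fun t => X₀ * volterraOp (fun _ _ => 1) v t ω :=
    (hV.integrable (by norm_num)).const_mul X₀
  have j3 : Integrable fun t => v t ω * volterraOp (kernelH φ ϱ) u t ω := hy.integrable_mul hHu
  have j4 : Integrable fun t : Set.Icc (0 : ℝ) T => v t ω * (T - t) := by
    refine (hy.integrable (by norm_num)).mul_bdd (c := T)
      (measurable_const.sub measurable_subtype_coe).aestronglyMeasurable (ae_of_all _ fun t => ?_)
    have h1 := t.2.1
    have h2 := t.2.2
    rw [Real.norm_eq_abs, abs_of_nonneg (by linarith)]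
    linarith
  have j5 : Integrable fun t : Set.Icc (0 : ℝ) T => X₀ * φ * (v t ω * (T - t)) + X₀ * ϱ * v t ω :=
    (j4.const_mul _).add ((hy.integrable (by norm_num)).const_mul _)
  have e1 : ∫ t, inventory X₀ u t ω * volterraOp (fun _ _ => 1) v t ω
      = X₀ * (∫ t, v t ω * (T - t))
        + ∫ t, (∫ r in Set.Iic t, u r ω) * ∫ s in Set.Iic t, v s ω := by
    rw [← integral_integral_Iic (hy.integrable (by norm_num)), ← integral_const_mul]
    simp only [volterraOp, one_mul] at j1 j2
    rw [← integral_add j2 j1]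
    refine integral_congr_ae (ae_of_all _ fun t => ?_)
    simp only [inventory, volterraOp, one_mul]
    ring
  have e2 : ∫ t : Set.Icc (0 : ℝ) T, v t ω
      * (X₀ * (φ * (T - t) + ϱ) + volterraOp (kernelH φ ϱ) u t ω)
      = X₀ * φ * (∫ t, v t ω * (T - t)) + X₀ * ϱ * (∫ t, v t ω)
        + ∫ t, v t ω * volterraOp (kernelH φ ϱ) u t ω := by
    rw [← integral_const_mul, ← integral_const_mul,
      ← integral_add (j4.const_mul _) ((hy.integrable (by norm_num)).const_mul _),
      ← integral_add j5 j3]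
    exact integral_congr_ae (ae_of_all _ fun t => by ring)
  have e3 : ∫ t, volterraOp (kernelH φ ϱ) v t ω * u t ω
      = ∫ t, u t ω * volterraOp (kernelH φ ϱ) v t ω :=
    integral_congr_ae (ae_of_all _ fun t => mul_comm _ _)
  have e4 := integral_penalty_eq hφ hϱ (hx.integrable (by norm_num)) (hy.integrable (by norm_num))
  have e5 : inventory X₀ u (endTime hT) ω * volterraOp (fun _ _ => 1) v (endTime hT) ω
      = (X₀ + ∫ r, u r ω) * ∫ s, v s ω := by
    simp only [inventory, volterraOp, one_mul, Iic_endTime, Measure.restrict_univ]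
  simp only [e1, e2, e3, e5]
  unfold volterraOp
  linear_combination e4

/-! ### The first-order condition -/

theorem integral_add_mul_sq {α : Type*} [MeasurableSpace α] {μ : Measure α} {x y : α → ℝ}
    (hx : MemLp x 2 μ) (hy : MemLp y 2 μ) (ε : ℝ) :
    ∫ a, (x a + ε * y a) ^ 2 ∂μ
      = ∫ a, x a ^ 2 ∂μ + ε * (2 * ∫ a, x a * y a ∂μ) + ε ^ 2 * ∫ a, y a ^ 2 ∂μ := by
  have i1 : Integrable (fun a => x a * y a) μ := hx.integrable_mul hy
  have i2 : Integrable (fun a => x a ^ 2 + ε * (2 * (x a * y a))) μ :=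
    hx.integrable_sq.add ((i1.const_mul 2).const_mul ε)
  rw [← integral_const_mul, ← integral_const_mul, ← integral_const_mul,
    ← integral_add hx.integrable_sq ((i1.const_mul 2).const_mul ε),
    ← integral_add i2 (hy.integrable_sq.const_mul _)]
  exact integral_congr_ae (ae_of_all _ fun a => by ring)

theorem hasDerivAt_integral_comp_mul {α : Type*} [MeasurableSpace α] {μ : Measure α}
    [IsFiniteMeasure μ] {h : ℝ → ℝ} {L : NNReal} (hL : LipschitzWith L h) (hd : Differentiable ℝ h)
    {z y x w : α → ℝ} (hz : MemLp z 2 μ) (hy : MemLp y 2 μ) (hx : MemLp x 2 μ) (hw : MemLp w 2 μ) :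
    HasDerivAt (fun ε => ∫ a, h (z a + ε * y a) * (x a + ε * w a) ∂μ)
      (∫ a, (y a * (deriv h (z a) * x a) + h (z a) * w a) ∂μ) 0 := by
  have hh := memLp_comp_lipschitz hL hz
  have hdb : ∀ b, |deriv h b| ≤ L := fun b => by
    simpa only [Real.norm_eq_abs] using norm_deriv_le_of_lipschitz (x₀ := b) hL
  have key : ∀ F F' : ℝ → α → ℝ, ∀ bound : α → ℝ,
      (∀ ε, AEStronglyMeasurable (F ε) μ) → Integrable (F 0) μ → AEStronglyMeasurable (F' 0) μ →
      (∀ a, ∀ ε ∈ Metric.ball (0 : ℝ) 1, ‖F' ε a‖ ≤ bound a) → Integrable bound μ →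
      (∀ a, ∀ ε ∈ Metric.ball (0 : ℝ) 1, HasDerivAt (fun ε => F ε a) (F' ε a) ε) →
      HasDerivAt (fun ε => ∫ a, F ε a ∂μ) (∫ a, F' 0 a ∂μ) 0 :=
    fun F F' bound h1 h2 h3 h4 h5 h6 => (hasDerivAt_integral_of_dominated_loc_of_deriv_le
      (Metric.ball_mem_nhds 0 one_pos) (Eventually.of_forall h1) h2 h3 (ae_of_all _ h4) h5
      (ae_of_all _ h6)).2
  refine (key (fun ε a => h (z a + ε * y a) * (x a + ε * w a))
    (fun ε a => deriv h (z a + ε * y a) * y a * (x a + ε * w a) + h (z a + ε * y a) * w a)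
    -- For `|ε| < 1` the Lipschitz constant bounds both `h'` and the increment of `h`, leaving sums
    -- of products of two `L²` functions.
    (fun a => L * |y a| * (|x a| + |w a|) + (|h (z a)| + L * |y a|) * |w a|)
    ?_ ?_ ?_ ?_ ?_ ?_).congr_deriv ?_
  · refine fun ε => ?_
    exact (memLp_comp_lipschitz hL (hz.add (hy.const_mul ε))).aestronglyMeasurable.mul
      (hx.add (hw.const_mul ε)).aestronglyMeasurable
  · simp only [zero_mul, add_zero]
    exact hh.integrable_mul hx
  · simp only [zero_mul, add_zero]
    exact ((((measurable_deriv h).comp_aemeasurable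
      hz.aestronglyMeasurable.aemeasurable).aestronglyMeasurable.mul hy.aestronglyMeasurable).mul
      hx.aestronglyMeasurable).add (hh.aestronglyMeasurable.mul hw.aestronglyMeasurable)
  · refine fun a ε hε => ?_
    have hε1 : |ε| ≤ 1 := by
      rw [Metric.mem_ball, dist_zero_right, Real.norm_eq_abs] at hε
      exact hε.le
    have b1 : |x a + ε * w a| ≤ |x a| + |w a| := by
      refine (abs_add_le _ _).trans ?_
      rw [abs_mul]
      gcongr
      exact mul_le_of_le_one_left (abs_nonneg _) hε1
    have b2 : |h (z a + ε * y a)| ≤ |h (z a)| + L * |y a| := by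
      have h1 := hL.dist_le_mul (z a + ε * y a) (z a)
      rw [Real.dist_eq, Real.dist_eq, add_sub_cancel_left, abs_mul] at h1
      have h2 : |h (z a + ε * y a)| ≤ |h (z a)| + |h (z a + ε * y a) - h (z a)| := by
        have := abs_add_le (h (z a)) (h (z a + ε * y a) - h (z a))
        rwa [add_sub_cancel] at this
      refine h2.trans ?_
      gcongr
      refine h1.trans ?_
      gcongr
      exact mul_le_of_le_one_left (abs_nonneg _) hε1
    rw [Real.norm_eq_abs]
    refine (abs_add_le _ _).trans ?_
    rw [abs_mul, abs_mul, abs_mul]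
    gcongr
    exact hdb _
  · have i1 := ((hy.abs.const_mul (L : ℝ)).integrable_mul (hx.abs.add hw.abs))
    have i2 := (hh.abs.add (hy.abs.const_mul (L : ℝ))).integrable_mul hw.abs
    exact i1.add i2
  · refine fun a ε _ => ?_
    have h1 : HasDerivAt (fun ε => z a + ε * y a) (y a) ε := by
      simpa using ((hasDerivAt_id ε).mul_const (y a)).const_add (z a)
    have h2 : HasDerivAt (fun ε => x a + ε * w a) (w a) ε := by
      simpa using ((hasDerivAt_id ε).mul_const (w a)).const_add (x a)
    exact (((hd _).hasDerivAt).comp ε h1).mul h2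
  · refine integral_congr_ae (ae_of_all _ fun a => ?_)
    simp only [zero_mul, add_zero]
    ring

/-- Along the line `u + εv` the functional is a quadratic polynomial in `ε` minus the impact
integral, hence differentiable at `0`, where it has a maximum. -/
theorem firstOrderCondition [Countable Ω] [DiscreteMeasurableSpace Ω] (hT : 0 < T)
    {γ φ ϱ X₀ : ℝ} {h : ℝ → ℝ} {L : NNReal} (hL : LipschitzWith L h) (hd : Differentiable ℝ h)
    (hG : AdmissibleKernel G) {S : Set.Icc (0 : ℝ) T → Ω → ℝ} (hS : MemL2 ℱ P S)
    (hST : MemLp (S (endTime hT)) 2 P) (hg : MemL2 ℱ P g)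
    (hu : IsGlobalMaximizer hT ℱ P γ φ ϱ X₀ h G S g u) (hv : MemL2 ℱ P v)
    {a : Set.Icc (0 : ℝ) T × Ω → ℝ} (ha2 : MemLp a 2 (volume.prod P))
    (ha : ∀ᵐ p ∂(volume.prod P), alphaSignal hT ℱ P S p.1 p.2 = a p) :
    ∫ p : Set.Icc (0 : ℝ) T × Ω, a p * v p.1 p.2 ∂(volume.prod P)
      - γ * ∫ p : Set.Icc (0 : ℝ) T × Ω, u p.1 p.2 * v p.1 p.2 ∂(volume.prod P)
      - ∫ p : Set.Icc (0 : ℝ) T × Ω, (volterraOp G v p.1 p.2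
          * (deriv h (distortion G g u p.1 p.2) * u p.1 p.2)
        + h (distortion G g u p.1 p.2) * v p.1 p.2) ∂(volume.prod P)
      - φ * ∫ p : Set.Icc (0 : ℝ) T × Ω, inventory X₀ u p.1 p.2
        * volterraOp (fun _ _ => 1) v p.1 p.2 ∂(volume.prod P)
      - ϱ * ∫ ω, inventory X₀ u (endTime hT) ω * volterraOp (fun _ _ => 1) v (endTime hT) ω ∂P
      = 0 := by
  obtain ⟨hu, hmax⟩ := hu
  have hum := (measurable_progSigma.1 ((memL2_iff hT).1 hu).1).1
  have hvm := (measurable_progSigma.1 ((memL2_iff hT).1 hv).1).1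
  have hu2 := hu.2
  have hv2 := hv.2
  have h1 := admissibleKernel_one (T := T)
  have hline : ∀ {K : Set.Icc (0 : ℝ) T → Set.Icc (0 : ℝ) T → ℝ}, AdmissibleKernel K →
      ∀ ε t ω, P {ω} ≠ 0 → volterraOp K (fun s ω' => u s ω' + ε * v s ω') t ω
        = volterraOp K u t ω + ε * volterraOp K v t ω := fun hK ε t ω hω =>
    volterraOp_add_mul hK (memLp_section hum hu2 hω) (memLp_section hvm hv2 hω) ε t
  have hX := memLp_inventory X₀ hum hu2
  have hV := memLp_volterraOp h1 hvm hv2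
  have hXT := memLp_inventory_apply X₀ hum hu2 (endTime hT)
  have hVT := (memLp_volterraOp_apply h1 hvm hv2 (endTime hT)).1
  have hΦ := hasDerivAt_integral_comp_mul hL hd (memLp_distortion hG hg.2 hum hu2)
    (memLp_volterraOp hG hvm hv2) hu2 hv2
  set μ := (volume : Measure (Set.Icc (0 : ℝ) T)).prod P
  set Φ := fun ε : ℝ => ∫ p : Set.Icc (0 : ℝ) T × Ω,
    h (distortion G g u p.1 p.2 + ε * volterraOp G v p.1 p.2) * (u p.1 p.2 + ε * v p.1 p.2) ∂μ
  have hJ : ∀ ε, performance hT ℱ P γ φ ϱ X₀ h G S g (fun t ω => u t ω + ε * v t ω)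
      = (∫ p : Set.Icc (0 : ℝ) T × Ω, a p * u p.1 p.2 ∂μ
          + ε * ∫ p : Set.Icc (0 : ℝ) T × Ω, a p * v p.1 p.2 ∂μ)
        - γ / 2 * (∫ p : Set.Icc (0 : ℝ) T × Ω, u p.1 p.2 ^ 2 ∂μ
          + ε * (2 * ∫ p : Set.Icc (0 : ℝ) T × Ω, u p.1 p.2 * v p.1 p.2 ∂μ)
          + ε ^ 2 * ∫ p : Set.Icc (0 : ℝ) T × Ω, v p.1 p.2 ^ 2 ∂μ)
        - Φ ε
        - φ / 2 * (∫ p : Set.Icc (0 : ℝ) T × Ω, inventory X₀ u p.1 p.2 ^ 2 ∂μ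
          + ε * (2 * ∫ p : Set.Icc (0 : ℝ) T × Ω, inventory X₀ u p.1 p.2
            * volterraOp (fun _ _ => 1) v p.1 p.2 ∂μ)
          + ε ^ 2 * ∫ p : Set.Icc (0 : ℝ) T × Ω, volterraOp (fun _ _ => 1) v p.1 p.2 ^ 2 ∂μ)
        - ϱ / 2 * (∫ ω, inventory X₀ u (endTime hT) ω ^ 2 ∂P
          + ε * (2 * ∫ ω, inventory X₀ u (endTime hT) ω
            * volterraOp (fun _ _ => 1) v (endTime hT) ω ∂P)
          + ε ^ 2 * ∫ ω, volterraOp (fun _ _ => 1) v (endTime hT) ω ^ 2 ∂P)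
        + X₀ * ∫ ω, S (endTime hT) ω ∂P := by
    intro ε
    rw [performance_eq hT γ φ ϱ X₀ hL hG hS hST hg (memL2_add_mul hT hu hv ε) ha2 ha,
      ← integral_add_mul_sq hu2 hv2, ← integral_add_mul_sq hX hV, ← integral_add_mul_sq hXT hVT]
    have i1 : Integrable (fun p : Set.Icc (0 : ℝ) T × Ω => a p * u p.1 p.2) μ :=
      ha2.integrable_mul hu2
    have i2 : Integrable (fun p : Set.Icc (0 : ℝ) T × Ω => a p * v p.1 p.2) μ :=
      ha2.integrable_mul hv2
    congr 1
    congr 1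
    · congr 1
      · congr 1
        · congr 1
          rw [← integral_const_mul, ← integral_add i1 (i2.const_mul ε)]
          exact integral_congr_ae (ae_of_all _ fun p => by ring)
        · refine integral_congr_ae ?_
          filter_upwards [ae_prod_singleton_ne_zero P] with p hp
          simp only [distortion, hline hG ε p.1 p.2 hp, add_assoc]
      · congr 1
        refine integral_congr_ae ?_
        filter_upwards [ae_prod_singleton_ne_zero P] with p hp
        simp only [inventory_eq_add_volterraOp, hline h1 ε p.1 p.2 hp, add_assoc]
    · congr 1
      refine integral_congr_ae ?_
      filter_upwards [ae_singleton_ne_zero P] with ω hω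
      simp only [inventory_eq_add_volterraOp, hline h1 ε (endTime hT) ω hω, add_assoc]
  have hlin : ∀ c d : ℝ, HasDerivAt (fun ε : ℝ => c + ε * d) d 0 := fun c d => by
    simpa using ((hasDerivAt_id (0 : ℝ)).mul_const d).const_add c
  have hquad : ∀ c d e : ℝ, HasDerivAt (fun ε : ℝ => c + ε * (2 * d) + ε ^ 2 * e) (2 * d) 0 :=
    fun c d e => by
      refine ((hlin c (2 * d)).add ((hasDerivAt_pow 2 (0 : ℝ)).mul_const e)).congr_deriv ?_
      simp
  have hderiv := (((((hlin (∫ p : Set.Icc (0 : ℝ) T × Ω, a p * u p.1 p.2 ∂μ)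
      (∫ p : Set.Icc (0 : ℝ) T × Ω, a p * v p.1 p.2 ∂μ)).sub
    ((hquad (∫ p : Set.Icc (0 : ℝ) T × Ω, u p.1 p.2 ^ 2 ∂μ)
      (∫ p : Set.Icc (0 : ℝ) T × Ω, u p.1 p.2 * v p.1 p.2 ∂μ)
      (∫ p : Set.Icc (0 : ℝ) T × Ω, v p.1 p.2 ^ 2 ∂μ)).const_mul (γ / 2))).sub hΦ).sub
    ((hquad (∫ p : Set.Icc (0 : ℝ) T × Ω, inventory X₀ u p.1 p.2 ^ 2 ∂μ)
      (∫ p : Set.Icc (0 : ℝ) T × Ω, inventory X₀ u p.1 p.2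
        * volterraOp (fun _ _ => 1) v p.1 p.2 ∂μ)
      (∫ p : Set.Icc (0 : ℝ) T × Ω, volterraOp (fun _ _ => 1) v p.1 p.2 ^ 2 ∂μ)).const_mul
      (φ / 2))).sub
    ((hquad (∫ ω, inventory X₀ u (endTime hT) ω ^ 2 ∂P)
      (∫ ω, inventory X₀ u (endTime hT) ω * volterraOp (fun _ _ => 1) v (endTime hT) ω ∂P)
      (∫ ω, volterraOp (fun _ _ => 1) v (endTime hT) ω ^ 2 ∂P)).const_mul (ϱ / 2))).add_const
    (X₀ * ∫ ω, S (endTime hT) ω ∂P)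
  have hderiv' := hderiv.congr_of_eventuallyEq (Eventually.of_forall hJ)
  have hloc : IsLocalMax (fun ε : ℝ => performance hT ℱ P γ φ ϱ X₀ h G S g
      (fun t ω => u t ω + ε * v t ω)) 0 := by
    refine Eventually.of_forall fun ε => ?_
    simp only [zero_mul, add_zero]
    exact hmax _ (memL2_add_mul hT hu hv ε)
  have := hloc.hasDerivAt_eq_zero hderiv'
  linear_combination this

end

/-! ### From the first-order condition to the Fredholm equation -/

section

variable {T : ℝ} {Ω : Type*} [mΩ : MeasurableSpace Ω]
  {P : Measure Ω} [IsProbabilityMeasure P]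
  {ℱ : Filtration (Set.Icc (0 : ℝ) T) mΩ} {G : Set.Icc (0 : ℝ) T → Set.Icc (0 : ℝ) T → ℝ}
  {g u : Set.Icc (0 : ℝ) T → Ω → ℝ}

/-- Only sets of `m` can be tested, so the usual criterion is applied to the trimmed measure, for
which `f` is still measurable. -/
theorem ae_eq_zero_of_forall_setIntegral_trim {α : Type*} {m m0 : MeasurableSpace α} (hm : m ≤ m0)
    {μ : Measure α} {f : α → ℝ} (hf : Measurable[m] f) (hi : Integrable f μ)
    (h : ∀ A, MeasurableSet[m] A → ∫ a in A, f a ∂μ = 0) : f =ᵐ[μ] 0 := by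
  have hs : StronglyMeasurable[m] f := hf.stronglyMeasurable
  refine ae_eq_of_ae_eq_trim (hm := hm) ?_
  refine (hi.trim hm hs).ae_eq_zero_of_forall_setIntegral_eq_zero fun A hA _ => ?_
  rw [← setIntegral_trim hm hs hA]
  exact h A hA

theorem memLp_deriv_comp_mul {α : Type*} [MeasurableSpace α] {μ : Measure α} {h : ℝ → ℝ}
    {L : NNReal} (hL : LipschitzWith L h) {z x : α → ℝ} (hz : AEStronglyMeasurable z μ)
    (hx : MemLp x 2 μ) : MemLp (fun a => deriv h (z a) * x a) 2 μ := by
  refine MemLp.of_le_mul (c := L) hx (((measurable_deriv h).comp_aemeasurable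
    hz.aemeasurable).aestronglyMeasurable.mul hx.aestronglyMeasurable) (ae_of_all _ fun a => ?_)
  rw [norm_mul]
  exact mul_le_mul_of_nonneg_right (norm_deriv_le_of_lipschitz hL) (norm_nonneg _)

variable [Countable Ω] [DiscreteMeasurableSpace Ω]

theorem fredholmIntegralsConverge {φ ϱ : ℝ} (hφ : 0 ≤ φ) (hϱ : 0 ≤ ϱ)
    {h : ℝ → ℝ} {L : NNReal} (hL : LipschitzWith L h) (hG : AdmissibleKernel G)
    (hg : Measurable fun p : Set.Icc (0 : ℝ) T × Ω => g p.1 p.2)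
    (hu : Measurable fun p : Set.Icc (0 : ℝ) T × Ω => u p.1 p.2)
    (hu2 : MemLp (fun p : Set.Icc (0 : ℝ) T × Ω => u p.1 p.2) 2 (volume.prod P)) :
    FredholmIntegralsConverge ℱ P φ ϱ h G g u := by
  have hH := admissibleKernel_kernelH (T := T) hφ hϱ
  have hZ := measurable_distortion hG hg hu
  have hwm : Measurable fun p : Set.Icc (0 : ℝ) T × Ω =>
    deriv h (distortion G g u p.1 p.2) * u p.1 p.2 := ((measurable_deriv h).comp hZ).mul hu
  have hw2 := memLp_deriv_comp_mul hL hZ.aestronglyMeasurable hu2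
  filter_upwards [ae_prod_singleton_ne_zero P, volterraAdj_ae_eq (ℱ := ℱ)
      (w := fun t ω => deriv h (distortion G g u t ω) * u t ω) hG hwm
      (hw2.integrable (by norm_num)),
    volterraAdj_ae_eq (ℱ := ℱ) hH hu (hu2.integrable (by norm_num))] with p hp h1 h2
  exact ⟨hG.integrableOn_mul (memLp_section hu hu2 hp) p.1, h1.1,
    hH.integrableOn_mul (memLp_section hu hu2 hp) p.1, h2.1⟩

theorem IsGlobalMaximizer.isFredholmSolution (hT : 0 < T) {γ φ ϱ X₀ : ℝ} (hφ : 0 ≤ φ) (hϱ : 0 ≤ ϱ)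
    {h : ℝ → ℝ} {L : NNReal} (hL : LipschitzWith L h) (hd : Differentiable ℝ h)
    (hG : AdmissibleKernel G) {S : Set.Icc (0 : ℝ) T → Ω → ℝ} (hS : MemL2 ℱ P S)
    (hST : MemLp (S (endTime hT)) 2 P) (hg : MemL2 ℱ P g)
    (hu : IsGlobalMaximizer hT ℱ P γ φ ϱ X₀ h G S g u) :
    IsFredholmSolution hT ℱ P γ φ ϱ X₀ h G S g u := by
  refine ⟨hu.1, ?_⟩
  obtain ⟨a, ham, ha2, haeq⟩ := exists_alphaSignal_version hT hS hST
  have hH := admissibleKernel_kernelH (T := T) hφ hϱ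
  have hup := ((memL2_iff hT).1 hu.1).1
  have hum := (measurable_progSigma.1 hup).1
  have hu2 := hu.1.2
  have hgp := ((memL2_iff hT).1 hg).1
  have hgm := (measurable_progSigma.1 hgp).1
  have hZm := measurable_distortion hG hgm hum
  have hZp : Measurable[progSigma ℱ] fun p : Set.Icc (0 : ℝ) T × Ω => distortion G g u p.1 p.2 :=
    hgp.add (progMeasurable_volterraOp hG hup)
  have hZ2 := memLp_distortion hG hg.2 hum hu2
  have hh := memLp_comp_lipschitz hL hZ2
  have hwm : Measurable fun p : Set.Icc (0 : ℝ) T × Ω =>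
    deriv h (distortion G g u p.1 p.2) * u p.1 p.2 := ((measurable_deriv h).comp hZm).mul hum
  have hw2 := memLp_deriv_comp_mul hL hZm.aestronglyMeasurable hu2
  have hw1 := hw2.integrable (by norm_num)
  have hu1 := hu2.integrable (by norm_num)
  have hHu := memLp_volterraOp hH hum hu2
  have hc := memLp_initialPenalty (T := T) (P := P) hφ hϱ X₀
  set w : Set.Icc (0 : ℝ) T → Ω → ℝ := fun t ω => deriv h (distortion G g u t ω) * u t ω
  set μ := (volume : Measure (Set.Icc (0 : ℝ) T)).prod P
  set c : Set.Icc (0 : ℝ) T × Ω → ℝ := fun p => X₀ * (φ * (T - p.1) + ϱ)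
  -- The defect of the equation without its two adjoint terms, with the signal replaced by its
  -- progressively measurable version.
  set f : Set.Icc (0 : ℝ) T × Ω → ℝ := fun p => γ * u p.1 p.2 + h (distortion G g u p.1 p.2)
    + (c p + volterraOp (kernelH φ ϱ) u p.1 p.2) - a p with hf
  have hcp : Measurable[progSigma ℱ] c :=
    measurable_progSigma.2 ⟨by fun_prop, fun t =>
      (measurable_const : Measurable[ℱ t] fun _ : Ω => X₀ * (φ * (T - t) + ϱ))⟩
  have hfp : Measurable[progSigma ℱ] f :=
    (((hup.const_mul γ).add (hL.continuous.measurable.comp hZp)).add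
      (hcp.add (progMeasurable_volterraOp hH hup))).sub ham
  have hf1 : Integrable f μ :=
    ((((hu2.const_mul γ).add hh).add (hc.add hHu)).sub ha2).integrable (by norm_num)
  have hG1 : Integrable (adjVersion ℱ P G w) μ := integrable_adjVersion hG hwm hw1
  have hH1 : Integrable (adjVersion ℱ P (kernelH φ ϱ) u) μ := integrable_adjVersion hH hum hu1
  have hzero : (fun p => f p + adjVersion ℱ P G w p + adjVersion ℱ P (kernelH φ ϱ) u p)
      =ᵐ[μ] 0 := by
    refine ae_eq_zero_of_forall_setIntegral_trim (progSigma_le ℱ)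
      ((hfp.add (progMeasurable_adjVersion hG hwm)).add (progMeasurable_adjVersion hH hum))
      ((hf1.add hG1).add hH1) fun A hA => ?_
    have hAm := progSigma_le ℱ A hA
    have hvm := measurable_indicator_one hAm
    have hv2 := memLp_indicator_one (P := P) hAm
    -- The indicator of a progressive set is an admissible direction, so the first-order condition
    -- becomes a statement about integrals over `A`.
    have hv : MemL2 ℱ P fun t ω => A.indicator 1 (t, ω) :=
      (memL2_iff hT).2 ⟨(measurable_const : Measurable[progSigma ℱ]
        fun _ : Set.Icc (0 : ℝ) T × Ω => (1 : ℝ)).indicator hA, hv2⟩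
    have hfoc := firstOrderCondition hT hL hd hG hS hST hg hu hv ha2 haeq
    have hpen := integral_inventory_mul_eq (v := fun t ω => A.indicator 1 (t, ω)) hT hφ hϱ X₀ hum hu2
      hvm hv2
    have hadjG := setIntegral_adjVersion (ℱ := ℱ) (w := w) hG hwm hw2 hA
    have hadjH := setIntegral_adjVersion (ℱ := ℱ) hH hum hu2 hA
    set v : Set.Icc (0 : ℝ) T → Ω → ℝ := fun t ω => A.indicator 1 (t, ω)
    have k1 : Integrable (fun p : Set.Icc (0 : ℝ) T × Ω => a p * v p.1 p.2) μ :=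
      ha2.integrable_mul hv2
    have k2 : Integrable (fun p : Set.Icc (0 : ℝ) T × Ω => u p.1 p.2 * v p.1 p.2) μ :=
      hu2.integrable_mul hv2
    have k3 : Integrable (fun p : Set.Icc (0 : ℝ) T × Ω =>
      h (distortion G g u p.1 p.2) * v p.1 p.2) μ := hh.integrable_mul hv2
    have k4 : Integrable (fun p : Set.Icc (0 : ℝ) T × Ω =>
      v p.1 p.2 * (c p + volterraOp (kernelH φ ϱ) u p.1 p.2)) μ := hv2.integrable_mul (hc.add hHu)
    have k5 : Integrable (fun p : Set.Icc (0 : ℝ) T × Ω => volterraOp G v p.1 p.2 * w p.1 p.2) μ :=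
      (memLp_volterraOp hG hvm hv2).integrable_mul hw2
    have hfA : ∫ p in A, f p ∂μ
        = γ * ∫ p : Set.Icc (0 : ℝ) T × Ω, u p.1 p.2 * v p.1 p.2 ∂μ
          + ∫ p : Set.Icc (0 : ℝ) T × Ω, h (distortion G g u p.1 p.2) * v p.1 p.2 ∂μ
          + ∫ p : Set.Icc (0 : ℝ) T × Ω,
            v p.1 p.2 * (c p + volterraOp (kernelH φ ϱ) u p.1 p.2) ∂μ
          - ∫ p : Set.Icc (0 : ℝ) T × Ω, a p * v p.1 p.2 ∂μ := by
      have k6 : Integrable (fun p : Set.Icc (0 : ℝ) T × Ω => γ * (u p.1 p.2 * v p.1 p.2)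
        + h (distortion G g u p.1 p.2) * v p.1 p.2) μ := (k2.const_mul γ).add k3
      have k7 : Integrable (fun p : Set.Icc (0 : ℝ) T × Ω => γ * (u p.1 p.2 * v p.1 p.2)
        + h (distortion G g u p.1 p.2) * v p.1 p.2
        + v p.1 p.2 * (c p + volterraOp (kernelH φ ϱ) u p.1 p.2)) μ := k6.add k4
      rw [← integral_const_mul, ← integral_add (k2.const_mul γ) k3, ← integral_add k6 k4,
        ← integral_sub k7 k1, ← integral_indicator hAm]
      refine integral_congr_ae (ae_of_all _ fun p => ?_)
      by_cases hp : p ∈ A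
      · simp only [v, hf, Set.indicator_of_mem hp, Pi.one_apply]
        ring
      · simp [v, Set.indicator_of_notMem hp]
    have k8 : Integrable (fun p => f p + adjVersion ℱ P G w p) μ := hf1.add hG1
    rw [integral_add k8.integrableOn hH1.integrableOn,
      integral_add hf1.integrableOn hG1.integrableOn, hfA, hadjG, hadjH]
    rw [integral_add k5 k3] at hfoc
    linear_combination -hfoc - hpen
  filter_upwards [hzero, haeq, volterraAdj_ae_eq (ℱ := ℱ) (w := w) hG hwm hw1,
    volterraAdj_ae_eq (ℱ := ℱ) hH hum hu1] with p h0 h1 h2 h3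
  rw [operatorA, h1, h2.2, h3.2]
  simp only [hf, c, Pi.zero_apply] at h0
  linarith

end

end PriceImpact

theorem theorem2p2 {Ω : Type*} [Countable Ω] [mΩ : MeasurableSpace Ω] [DiscreteMeasurableSpace Ω]
    (P : Measure Ω) [IsProbabilityMeasure P]
    (T : ℝ) (hT : 0 < T)
    (ℱ : Filtration (Set.Icc (0 : ℝ) T) mΩ) (hℱ : UsualConditions ℱ P)
    (γ φ ϱ X₀ : ℝ) (hγ : 0 < γ) (hφ : 0 ≤ φ) (hϱ : 0 ≤ ϱ) (hX₀ : 0 < X₀)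
    (S : Set.Icc (0 : ℝ) T → Ω → ℝ) (hS : MemL2 ℱ P S) (hST : MemLp (S (endTime hT)) 2 P)
    (g : Set.Icc (0 : ℝ) T → Ω → ℝ) (hg : MemL2 ℱ P g)
    (G : Set.Icc (0 : ℝ) T → Set.Icc (0 : ℝ) T → ℝ) (hG : AdmissibleKernel G)
    (h : ℝ → ℝ) (hLip : ∃ L : NNReal, LipschitzWith L h) (hsub : StrictlySublinear h) :
    (∀ u, MemL2 ℱ P u → PerformanceWellDefined hT ℱ P γ X₀ h G S g u) ∧
    (∃ uhat, IsGlobalMaximizer hT ℱ P γ φ ϱ X₀ h G S g uhat) ∧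
    (DifferentiableBoundedDeriv h →
      ∀ uhat, IsGlobalMaximizer hT ℱ P γ φ ϱ X₀ h G S g uhat →
        FredholmIntegralsConverge ℱ P φ ϱ h G g uhat ∧
        IsFredholmSolution hT ℱ P γ φ ϱ X₀ h G S g uhat) := by
  obtain ⟨L, hL⟩ := hLip
  refine ⟨fun u hu => performanceWellDefined hT γ X₀ hL hG hS hST hg hu,
    exists_globalMaximizer hT X₀ hγ hφ hϱ hL hsub hG hS hST hg, fun hd uhat hmax => ⟨?_, ?_⟩⟩
  · exact fredholmIntegralsConverge hφ hϱ hL hG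
      (measurable_progSigma.1 ((memL2_iff hT).1 hg).1).1
      (measurable_progSigma.1 ((memL2_iff hT).1 hmax.1).1).1 hmax.1.2
  · exact hmax.isFredholmSolution hT hφ hϱ hL hd.1 hG hS hST hg
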